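/- Let $H^2$ be the hyperbolic plane (of curvature $-1$) with its geodesic metric $d$. For a convex body $K\subset H^2$ (a compact, geodesically convex set with non-empty interior), a supporting line of $K$ is a hyperbolic line that meets $K$ and has $K$ in one of its two closed half-planes; the width of $K$ with respect to a supporting line $\ell$ is the distance from $\ell$ to a most distant supporting line of $K$; and the minimal width $w(K)$ is the minimum of these widths over all supporting lines $\ell$ of $K$. A convex polygon $P\subset H^2$ with an odd number $n=2k+1$ of vertices $v_1,\dots,v_n$ in cyclic order (indices modulo $n$) is called an ordinary reduced polygon if for every $i$ the distance of $v_i$ from the opposite side $[v_{i+k},v_{i+k+1}]$ equals $w(P)$ and the orthogonal projection of $v_i$ on the line through that side lies in the relative interior of the side. For every ordinary reduced polygon $P\subset H^2$ one has $$1<\frac{\operatorname{diam}(P)}{w(P)}<2 .$$ Both constants are optimal: over all ordinary reduced polygons $P\subset H^2$, the infimum of $\operatorname{diam}(P)/w(P)$ is $1$ and its supremum is $2$. -/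

import Mathlib

open scoped UpperHalfPlane

noncomputable section

namespace HypPlane

/-! The hyperbolic plane is the upper half-plane `ℍ` with Mathlib's hyperbolic metric
(curvature `-1`). -/

/-- The geodesic segment `[x, y]`. -/
def segment (x y : ℍ) : Set ℍ :=
  {z | dist x z + dist z y = dist x y}

/-- The relative interior of the geodesic segment `[x, y]`, for `x ≠ y`. -/
def openSegment (x y : ℍ) : Set ℍ :=
  segment x y \ {x, y}

/-- Geodesic convexity. -/
def IsConvex (X : Set ℍ) : Prop :=
  ∀ x ∈ X, ∀ y ∈ X, segment x y ⊆ X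

/-- The convex hull: the intersection of all convex sets containing `X`. -/
def conv (X : Set ℍ) : Set ℍ :=
  ⋂₀ {C | IsConvex C ∧ X ⊆ C}

/-- A convex body is a compact convex set with non-empty interior. -/
def IsConvexBody (K : Set ℍ) : Prop :=
  IsConvex K ∧ IsCompact K ∧ (interior K).Nonempty

/-- For `4 * a * c < b ^ 2` the zero set of this function in `ℍ` is a hyperbolic line: a vertical
half-line if `a = 0`, and the upper half of a circle centred on the real axis if `a ≠ 0`. Every
hyperbolic line arises in this way. -/
def lineForm (a b c : ℝ) (z : ℍ) : ℝ :=
  a * (z.re ^ 2 + z.im ^ 2) + b * z.re + c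

/-- `H` is one of the two closed half-planes bounded by the hyperbolic line `l`. The other one is
obtained by changing the signs of `a`, `b`, `c`. -/
def IsClosedHalfPlane (H l : Set ℍ) : Prop :=
  ∃ a b c : ℝ, 4 * a * c < b ^ 2 ∧ l = {z | lineForm a b c z = 0} ∧ H = {z | 0 ≤ lineForm a b c z}

/-- `l` is a hyperbolic line (a complete geodesic). -/
def IsLine (l : Set ℍ) : Prop :=
  ∃ a b c : ℝ, 4 * a * c < b ^ 2 ∧ l = {z | lineForm a b c z = 0}

/-- `l` is a supporting line of `K`. -/
def IsSupportingLine (K l : Set ℍ) : Prop :=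
  IsLine l ∧ (K ∩ l).Nonempty ∧ ∃ H, IsClosedHalfPlane H l ∧ K ⊆ H

/-- The distance of two sets: the infimum of the distances of their points. -/
def setDist (A B : Set ℍ) : ℝ :=
  sInf {r | ∃ x ∈ A, ∃ y ∈ B, r = dist x y}

/-- The width of `K` with respect to the supporting line `l`: the distance of `l` to a most distant
supporting line of `K`. -/
def width (K l : Set ℍ) : ℝ :=
  sSup {r | ∃ l', IsSupportingLine K l' ∧ r = setDist l l'}

/-- The minimal width (thickness) of `K`. -/
def minimalWidth (K : Set ℍ) : ℝ :=
  sInf {r | ∃ l, IsSupportingLine K l ∧ r = width K l}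

/-- `t` is the orthogonal projection of `x` on the line `l`, i.e. the point of `l` nearest to `x`. -/
def IsProjection (x : ℍ) (l : Set ℍ) (t : ℍ) : Prop :=
  t ∈ l ∧ ∀ z ∈ l, dist x t ≤ dist x z

/-- `P` is a convex `n`-gon with vertices `v 0, …, v (n - 1)` in cyclic order (in one of the two
orientations): `P` is a convex body, it is the convex hull of the distinct points `v i`, each
of them is a vertex, and the segments `[v i, v (i + 1)]` are sides, i.e. lie on supporting lines. -/
structure IsPolygon (n : ℕ) (v : ZMod n → ℍ) (P : Set ℍ) : Prop where
  eq_conv : P = conv (Set.range v)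
  convexBody : IsConvexBody P
  injective : Function.Injective v
  vertex : ∀ i, v i ∉ conv (Set.range v \ {v i})
  side : ∀ i, ∃ l, IsSupportingLine P l ∧ v i ∈ l ∧ v (i + 1) ∈ l

/-- `P` is an ordinary reduced polygon: a convex `n`-gon with `n = 2 * k + 1` odd, such that each
vertex `v i` has distance `minimalWidth P` from the opposite side `[v (i + k), v (i + k + 1)]`, and
its orthogonal projection on the line through that side is in the relative interior of the side. -/
def IsOrdinaryReducedPolygon (P : Set ℍ) : Prop :=
  ∃ (k : ℕ) (v : ZMod (2 * k + 1) → ℍ), IsPolygon (2 * k + 1) v P ∧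
    ∀ i, Metric.infDist (v i) (segment (v (i + k)) (v (i + k + 1))) = minimalWidth P ∧
      ∃ l t, IsLine l ∧ v (i + k) ∈ l ∧ v (i + k + 1) ∈ l ∧ IsProjection (v i) l t ∧
        t ∈ openSegment (v (i + k)) (v (i + k + 1))

/-- The set of the ratios of diameter and minimal width of ordinary reduced polygons. -/
def diamWidthRatios : Set ℝ :=
  {r | ∃ P, IsOrdinaryReducedPolygon P ∧ r = Metric.diam P / minimalWidth P}

end HypPlane

end

/-! In the hyperboloid model a point is a unit timelike vector, `cosh` of the distance is the
Minkowski product, segments consist of nonnegative combinations, lines are zero sets of linear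
functionals with spacelike normal, and orientation is the sign of a 3×3 determinant. The geometry
thus becomes polynomial algebra.

Bounds. Let `t i` be the foot of the altitude from `v i`, and `w` the common length of the
altitudes. The foot lies strictly inside a side, and `cosh (dist (v i) ·)` at such a point is a
positive combination, with weights of sum less than 1, of its values at the ends; so an end is
farther than `w` and the diameter exceeds `w`. Any two altitudes cross at a point `o`
(`exists_mem_segment_inter`, with the signs supplied by `IsPolygon.det3_pos`), and the triangle
inequality through `o` puts the two vertices at distance less than `2 * w`. Balls are convex, so the
diameter is attained at vertices (`IsPolygon.diam_bounds`).

Sharpness. The regular `(2 * k + 1)`-gon of circumradius `R` and inradius `r` has `tanh r = cos (π /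
n) * tanh R` and minimal width `R + r` (`minimalWidth_regularPolygon`). For `R = 1` and `k → ∞` the
diameter is at most 2 while the width tends to 2. For triangles with `R → ∞` the inradius stays
bounded and the diameter is at least `2 * R - 2`, so the ratio tends to 2. -/

namespace HypPlane

/-! ### The hyperboloid model -/

/-- Time coordinate of a point in the hyperboloid model. -/
noncomputable def vt (z : ℍ) : ℝ := (z.re ^ 2 + z.im ^ 2 + 1) / (2 * z.im)

/-- First space coordinate of a point in the hyperboloid model. -/
noncomputable def vu (z : ℍ) : ℝ := (z.re ^ 2 + z.im ^ 2 - 1) / (2 * z.im)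

/-- Second space coordinate of a point in the hyperboloid model. -/
noncomputable def vs (z : ℍ) : ℝ := z.re / z.im

theorem vec_sq (z : ℍ) : vt z ^ 2 - vu z ^ 2 - vs z ^ 2 = 1 := by
  have := z.im_pos
  unfold vt vu vs
  field_simp
  ring

theorem vt_pos (z : ℍ) : 0 < vt z := by
  have := z.im_pos
  unfold vt
  positivity

theorem cosh_dist_eq (z w : ℍ) :
    Real.cosh (dist z w) = vt z * vt w - vu z * vu w - vs z * vs w := by
  have := z.im_pos
  have := w.im_pos
  rw [UpperHalfPlane.cosh_dist']
  unfold vt vu vs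
  field_simp
  ring

theorem ext_vec {z w : ℍ} (ht : vt z = vt w) (hu : vu z = vu w) (hs : vs z = vs w) : z = w := by
  by_contra hne
  refine (Real.one_lt_cosh.2 (dist_pos.2 hne).ne').ne' ?_
  rw [cosh_dist_eq, ht, hu, hs]
  linear_combination vec_sq w

theorem exists_vec {t u s : ℝ} (h : t ^ 2 - u ^ 2 - s ^ 2 = 1) (ht : 0 < t) :
    ∃ z : ℍ, vt z = t ∧ vu z = u ∧ vs z = s := by
  have h1 : 0 < t - u := by nlinarith [sq_nonneg s]
  have hs2 : s ^ 2 = (t - u) * (t + u) - 1 := by linarith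
  refine ⟨⟨⟨s / (t - u), 1 / (t - u)⟩, by positivity⟩, ?_, ?_, ?_⟩ <;>
    simp only [vt, vu, vs, UpperHalfPlane.mk_re, UpperHalfPlane.mk_im] <;> field_simp <;>
    (try rw [hs2]) <;> ring

theorem exists_vec_normalize {t u s : ℝ} (h : 0 < t ^ 2 - u ^ 2 - s ^ 2) (ht : 0 < t) :
    ∃ z : ℍ, ∃ q : ℝ, 0 < q ∧ vt z = q * t ∧ vu z = q * u ∧ vs z = q * s := by
  have hq : 0 < (√(t ^ 2 - u ^ 2 - s ^ 2))⁻¹ := inv_pos.2 (Real.sqrt_pos.2 h)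
  have hq2 : (√(t ^ 2 - u ^ 2 - s ^ 2))⁻¹ ^ 2 * (t ^ 2 - u ^ 2 - s ^ 2) = 1 := by
    rw [inv_pow, Real.sq_sqrt h.le, inv_mul_cancel₀ h.ne']
  generalize (√(t ^ 2 - u ^ 2 - s ^ 2))⁻¹ = q at hq hq2
  obtain ⟨z, h1, h2, h3⟩ := exists_vec (t := q * t) (u := q * u) (s := q * s)
    (by linear_combination hq2) (by positivity)
  exact ⟨z, q, hq, h1, h2, h3⟩

/-- A vector orthogonal to a timelike vector and isotropic vanishes. -/
theorem eq_zero_of_orthogonal {t u s : ℝ} (x : ℍ) (h : t * vt x - u * vu x - s * vs x = 0)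
    (h0 : 0 ≤ t ^ 2 - u ^ 2 - s ^ 2) : t = 0 ∧ u = 0 ∧ s = 0 := by
  have hx := vec_sq x
  have h1 : (t * vt x) ^ 2 ≤ (u ^ 2 + s ^ 2) * (vt x ^ 2 - 1) := by
    have e : t * vt x = u * vu x + s * vs x := by linarith
    have e2 : vt x ^ 2 - 1 = vu x ^ 2 + vs x ^ 2 := by linarith
    rw [e, e2]
    nlinarith [sq_nonneg (u * vs x - s * vu x)]
  have h2 : u ^ 2 + s ^ 2 ≤ 0 := by nlinarith [sq_nonneg (vt x)]
  have hu : u = 0 := by nlinarith [sq_nonneg u, sq_nonneg s]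
  have hs : s = 0 := by nlinarith [sq_nonneg u, sq_nonneg s]
  subst hu hs
  refine ⟨?_, rfl, rfl⟩
  have := vt_pos x
  have h3 : t * vt x = 0 := by linarith
  rcases mul_eq_zero.1 h3 with h4 | h4
  · exact h4
  · exact absurd h4 this.ne'

/-! ### Geodesic segments as nonnegative combinations -/

theorem one_lt_cosh_dist {x y : ℍ} (h : x ≠ y) : 1 < Real.cosh (dist x y) :=
  Real.one_lt_cosh.2 (dist_pos.2 h).ne'

/-- The vector of `z` is the combination of those of `x` and `y` with coefficients `l`, `m`. -/
structure Comb (l m : ℝ) (z x y : ℍ) : Prop where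
  t : vt z = l * vt x + m * vt y
  u : vu z = l * vu x + m * vu y
  s : vs z = l * vs x + m * vs y

theorem Comb.swap {l m : ℝ} {z x y : ℍ} (h : Comb l m z x y) : Comb m l z y x :=
  ⟨by rw [h.t]; ring, by rw [h.u]; ring, by rw [h.s]; ring⟩

theorem Comb.sq {l m : ℝ} {z x y : ℍ} (h : Comb l m z x y) :
    l ^ 2 + m ^ 2 + 2 * l * m * Real.cosh (dist x y) = 1 := by
  rw [cosh_dist_eq, ← vec_sq z, h.t, h.u, h.s]
  linear_combination (-l ^ 2) * vec_sq x - m ^ 2 * vec_sq y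

/-- Since `cosh ≥ 1`, `Comb.sq` gives `(l + m) ^ 2 ≤ 1`. This deficit in the weights makes balls
convex. -/
theorem Comb.add_le_one {l m : ℝ} {z x y : ℍ} (h : Comb l m z x y) (hl : 0 ≤ l) (hm : 0 ≤ m) :
    l + m ≤ 1 := by
  have := h.sq
  have := Real.one_le_cosh (dist x y)
  nlinarith [mul_nonneg hl hm]

theorem Comb.add_lt_one {l m : ℝ} {z x y : ℍ} (h : Comb l m z x y) (hl : 0 < l) (hm : 0 < m)
    (hxy : x ≠ y) : l + m < 1 := by
  have := h.sq
  have := one_lt_cosh_dist hxy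
  nlinarith [mul_pos hl hm]

theorem Comb.cosh_dist {l m : ℝ} {z x y : ℍ} (h : Comb l m z x y) (p : ℍ) :
    Real.cosh (dist p z) = l * Real.cosh (dist p x) + m * Real.cosh (dist p y) := by
  simp only [cosh_dist_eq, h.t, h.u, h.s]
  ring

theorem Comb.mem_segment {l m : ℝ} {z x y : ℍ} (h : Comb l m z x y) (hl : 0 ≤ l) (hm : 0 ≤ m) :
    z ∈ segment x y := by
  have hsq := h.sq
  have hx := h.cosh_dist x
  have hy := h.cosh_dist y
  rw [dist_self, Real.cosh_zero] at hx hy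
  rw [dist_comm y z, dist_comm y x] at hy
  have e1 : Real.sinh (dist x z) = m * Real.sinh (dist x y) := by
    rw [← sq_eq_sq₀ (Real.sinh_nonneg_iff.2 dist_nonneg)
      (mul_nonneg hm (Real.sinh_nonneg_iff.2 dist_nonneg)), mul_pow, Real.sinh_sq, Real.sinh_sq, hx]
    linear_combination hsq
  have e2 : Real.sinh (dist z y) = l * Real.sinh (dist x y) := by
    rw [← sq_eq_sq₀ (Real.sinh_nonneg_iff.2 dist_nonneg)
      (mul_nonneg hl (Real.sinh_nonneg_iff.2 dist_nonneg)), mul_pow, Real.sinh_sq, Real.sinh_sq, hy]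
    linear_combination hsq
  change dist x z + dist z y = dist x y
  have e3 : Real.cosh (dist x z + dist z y) = Real.cosh (dist x y) := by
    rw [Real.cosh_add, e1, e2, hx, hy]
    linear_combination Real.cosh (dist x y) * hsq + l * m * Real.sinh_sq (dist x y)
  have e4 := Real.cosh_le_cosh.1 e3.le
  have e5 := Real.cosh_le_cosh.1 e3.ge
  have : 0 ≤ dist x z + dist z y := by positivity
  rw [abs_of_nonneg this, abs_of_nonneg dist_nonneg] at *
  linarith

theorem mem_segment_iff {x y z : ℍ} :
    z ∈ segment x y ↔ ∃ l m, 0 ≤ l ∧ 0 ≤ m ∧ Comb l m z x y := by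
  refine ⟨fun h => ?_, fun ⟨l, m, hl, hm, h⟩ => h.mem_segment hl hm⟩
  change dist x z + dist z y = dist x y at h
  rcases eq_or_ne x y with rfl | hxy
  · have h0 : dist x z = 0 := by
      rw [dist_comm z x, dist_self] at h
      linarith
    obtain rfl := dist_eq_zero.1 h0
    exact ⟨1, 0, by simp, by simp, by simp, by simp, by simp⟩
  have hd : 0 < Real.sinh (dist x y) := Real.sinh_pos_iff.2 (dist_pos.2 hxy)
  have a1 := Real.sinh_sub (dist x y) (dist x z)
  have a2 := Real.sinh_sub (dist x y) (dist z y)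
  have a3 := Real.sinh_add (dist x z) (dist z y)
  rw [show dist x y - dist x z = dist z y by linarith] at a1
  rw [show dist x y - dist z y = dist x z by linarith] at a2
  rw [h] at a3
  set D := Real.sinh (dist x y)
  -- The hyperbolic sine rule dictates these weights. The residual `z - l x - m y` is then
  -- orthogonal to `x` and isotropic, hence zero.
  set l := Real.sinh (dist z y) / D with hl
  set m := Real.sinh (dist x z) / D with hm
  have hl' : Real.sinh (dist z y) = l * D := by rw [hl]; field_simp
  have hm' : Real.sinh (dist x z) = m * D := by rw [hm]; field_simp
  rw [hl', hm'] at a1 a2 a3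
  have b1 : Real.cosh (dist x z) = l + m * Real.cosh (dist x y) := by
    apply mul_left_cancel₀ hd.ne'
    linear_combination -a1
  have b2 : Real.cosh (dist z y) = m + l * Real.cosh (dist x y) := by
    apply mul_left_cancel₀ hd.ne'
    linear_combination -a2
  have b3 : 1 = l * Real.cosh (dist x z) + m * Real.cosh (dist z y) := by
    apply mul_left_cancel₀ hd.ne'
    linear_combination a3
  refine ⟨l, m, div_nonneg (Real.sinh_nonneg_iff.2 dist_nonneg) hd.le,
    div_nonneg (Real.sinh_nonneg_iff.2 dist_nonneg) hd.le, ?_⟩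
  rw [cosh_dist_eq, cosh_dist_eq] at b1 b2 b3
  have hx := vec_sq x
  have hy := vec_sq y
  have hz := vec_sq z
  obtain ⟨h1, h2, h3⟩ := eq_zero_of_orthogonal (t := vt z - l * vt x - m * vt y)
    (u := vu z - l * vu x - m * vu y) (s := vs z - l * vs x - m * vs y) x
    (by linear_combination b1 - l * hx) (by
      apply le_of_eq
      linear_combination -b3 - hz + l * b1 - l ^ 2 * hx + m * b2 - m ^ 2 * hy)
  exact ⟨by linarith, by linarith, by linarith⟩

/-- Combination with positive coefficients can be normalised to a point of the plane. -/
theorem exists_comb {a b : ℝ} (ha : 0 < a) (hb : 0 < b) (x y : ℍ) :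
    ∃ z : ℍ, ∃ q : ℝ, 0 < q ∧ Comb (q * a) (q * b) z x y := by
  have hx := vec_sq x
  have hy := vec_sq y
  have hc := Real.one_le_cosh (dist x y)
  rw [cosh_dist_eq] at hc
  have htx := vt_pos x
  have hty := vt_pos y
  obtain ⟨z, q, hq, h1, h2, h3⟩ := exists_vec_normalize (t := a * vt x + b * vt y)
    (u := a * vu x + b * vu y) (s := a * vs x + b * vs y)
    (by nlinarith [mul_pos ha hb, sq_nonneg a, sq_nonneg b]) (by positivity)
  exact ⟨z, q, hq, by rw [h1]; ring, by rw [h2]; ring, by rw [h3]; ring⟩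

/-! ### Linear functionals and determinants -/

/-- A linear functional on the hyperboloid. -/
noncomputable def lin (α β γ : ℝ) (z : ℍ) : ℝ := α * vt z + β * vu z + γ * vs z

/-- Up to the positive factor `z.im`, the quadratic form of a line is linear on the hyperboloid, so
half-planes become sign conditions on linear functionals. -/
theorem lineForm_eq (a b c : ℝ) (z : ℍ) : lineForm a b c z = z.im * lin (a + c) (a - c) b z := by
  have := z.im_pos
  unfold lineForm lin vt vu vs
  field_simp
  ring

theorem lin_eq (α β γ : ℝ) (z : ℍ) :
    lin α β γ z = lineForm ((α + β) / 2) γ ((α - β) / 2) z / z.im := by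
  have := z.im_pos
  rw [lineForm_eq, mul_div_cancel_left₀ _ this.ne']
  congr 1 <;> ring

theorem Comb.lin {l m : ℝ} {z x y : ℍ} (h : Comb l m z x y) (α β γ : ℝ) :
    lin α β γ z = l * lin α β γ x + m * lin α β γ y := by
  unfold HypPlane.lin
  rw [h.t, h.u, h.s]
  ring

theorem isLine_iff {l : Set ℍ} :
    IsLine l ↔ ∃ α β γ : ℝ, α ^ 2 < β ^ 2 + γ ^ 2 ∧ l = {z | lin α β γ z = 0} := by
  constructor
  · rintro ⟨a, b, c, h, rfl⟩
    refine ⟨a + c, a - c, b, by nlinarith, ?_⟩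
    ext z
    simp [lineForm_eq, z.im_pos.ne']
  · rintro ⟨α, β, γ, h, rfl⟩
    refine ⟨(α + β) / 2, γ, (α - β) / 2, by nlinarith, ?_⟩
    ext z
    simp [lin_eq, z.im_pos.ne']

theorem isSupportingLine_iff {K l : Set ℍ} :
    IsSupportingLine K l ↔ ∃ α β γ : ℝ, α ^ 2 < β ^ 2 + γ ^ 2 ∧ l = {z | lin α β γ z = 0} ∧
      (∀ z ∈ K, 0 ≤ lin α β γ z) ∧ ∃ z ∈ K, lin α β γ z = 0 := by
  constructor
  · rintro ⟨-, ⟨p, hpK, hpl⟩, H, ⟨a, b, c, h, rfl, rfl⟩, hK⟩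
    refine ⟨a + c, a - c, b, by nlinarith, ?_, fun z hz => ?_, p, hpK, ?_⟩
    · ext z
      simp [lineForm_eq, z.im_pos.ne']
    · have := hK hz
      rw [Set.mem_ofPred_eq, lineForm_eq] at this
      exact nonneg_of_mul_nonneg_right this z.im_pos
    · simpa [lineForm_eq, p.im_pos.ne'] using hpl
  · rintro ⟨α, β, γ, h, rfl, hK, p, hpK, hp⟩
    refine ⟨isLine_iff.2 ⟨α, β, γ, h, rfl⟩, ⟨p, hpK, hp⟩, {z | 0 ≤ lin α β γ z},
      ⟨(α + β) / 2, γ, (α - β) / 2, by nlinarith, ?_, ?_⟩, hK⟩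
    · ext z
      simp [lin_eq, z.im_pos.ne']
    · ext z
      simp only [Set.mem_ofPred_eq, lin_eq]
      rw [le_div_iff₀ z.im_pos, zero_mul]

/-- The determinant of three points in the hyperboloid model. -/
noncomputable def det3 (x y z : ℍ) : ℝ :=
  lin (vu x * vs y - vs x * vu y) (vs x * vt y - vt x * vs y) (vt x * vu y - vu x * vt y) z

theorem det3_cycle (x y z : ℍ) : det3 x y z = det3 y z x := by
  unfold det3 lin
  ring

theorem det3_swap_right (x y z : ℍ) : det3 x y z = -det3 x z y := by
  unfold det3 lin
  ring

theorem det3_self (x y : ℍ) : det3 x y y = 0 := by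
  unfold det3 lin
  ring

theorem det3_self_left (x y : ℍ) : det3 x y x = 0 := by
  unfold det3 lin
  ring

theorem Comb.det3 {l m : ℝ} {z x y : ℍ} (h : Comb l m z x y) (p q : ℍ) :
    det3 p q z = l * det3 p q x + m * det3 p q y :=
  h.lin _ _ _

theorem det3_pluecker (p u a b c : ℍ) :
    det3 p u a * det3 p b c - det3 p u b * det3 p a c + det3 p u c * det3 p a b = 0 := by
  unfold det3 lin
  ring

/-- Functionals vanishing at two distinct points are proportional; cross-multiplying avoids naming
the factor. -/
theorem lin_mul_det3 {α β γ : ℝ} {x y : ℍ} (hx : lin α β γ x = 0) (hy : lin α β γ y = 0)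
    (z w : ℍ) : lin α β γ z * det3 x y w = lin α β γ w * det3 x y z := by
  unfold det3 lin at *
  linear_combination
    (-(vt y * vu z * vs w - vt y * vs z * vu w - vu y * vt z * vs w + vu y * vs z * vt w
      + vs y * vt z * vu w - vs y * vu z * vt w)) * hx +
    (vt x * vu z * vs w - vt x * vs z * vu w - vu x * vt z * vs w + vu x * vs z * vt w
      + vs x * vt z * vu w - vs x * vu z * vt w) * hy

theorem exists_comb_of_det3_eq_zero {x y z : ℍ} (hxy : x ≠ y) (h : det3 x y z = 0) :
    ∃ l m, Comb l m z x y := by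
  have hc := one_lt_cosh_dist hxy
  have hx := vec_sq x
  have hy := vec_sq y
  have hz := vec_sq z
  set c := Real.cosh (dist x y) with hcdef
  obtain ⟨a, ha⟩ : ∃ a, a = vt x * vt z - vu x * vu z - vs x * vs z := ⟨_, rfl⟩
  obtain ⟨b, hb⟩ : ∃ b, b = vt y * vt z - vu y * vu z - vs y * vs z := ⟨_, rfl⟩
  have hcc : c = vt x * vt y - vu x * vu y - vs x * vs y := cosh_dist_eq x y
  have hd : 1 - c ^ 2 ≠ 0 := by nlinarith
  -- The Gram determinant of three vectors is the square of `det3`. Its vanishing makes the residual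
  -- after solving for `l`, `m` isotropic.
  have gram : 1 + 2 * a * b * c - a ^ 2 - b ^ 2 - c ^ 2 = 0 := by
    have e : (vt x ^ 2 - vu x ^ 2 - vs x ^ 2) * (vt y ^ 2 - vu y ^ 2 - vs y ^ 2) *
        (vt z ^ 2 - vu z ^ 2 - vs z ^ 2) + 2 * a * b * c
        - a ^ 2 * (vt y ^ 2 - vu y ^ 2 - vs y ^ 2) - b ^ 2 * (vt x ^ 2 - vu x ^ 2 - vs x ^ 2)
        - c ^ 2 * (vt z ^ 2 - vu z ^ 2 - vs z ^ 2) = det3 x y z ^ 2 := by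
      rw [ha, hb, hcc]
      unfold det3 lin
      ring
    rw [hx, hy, hz, h] at e
    linarith
  obtain ⟨l, hl⟩ : ∃ l, l = (a - b * c) / (1 - c ^ 2) := ⟨_, rfl⟩
  obtain ⟨m, hm⟩ : ∃ m, m = (b - a * c) / (1 - c ^ 2) := ⟨_, rfl⟩
  have e1 : a = l + m * c := by rw [hl, hm]; field_simp; ring
  have e2 : b = l * c + m := by rw [hl, hm]; field_simp; ring
  have e3 : 1 = l * a + m * b := by rw [hl, hm]; field_simp; linarith
  refine ⟨l, m, ?_⟩
  clear_value c
  obtain ⟨h1, h2, h3⟩ := eq_zero_of_orthogonal (t := vt z - l * vt x - m * vt y)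
    (u := vu z - l * vu x - m * vu y) (s := vs z - l * vs x - m * vs y) x
    (by linear_combination e1 - ha - l * hx + m * hcc) (by
      apply le_of_eq
      linear_combination -hz - l ^ 2 * hx - m ^ 2 * hy - e3 - l * ha - m * hb
        + l * (e1 - ha) + m * (e2 - hb) + 2 * l * m * hcc)
  exact ⟨by linarith, by linarith, by linarith⟩

/-! ### Convex sets -/

theorem subset_conv (X : Set ℍ) : X ⊆ conv X := fun _ hx _ hC => hC.2 hx

theorem isConvex_conv (X : Set ℍ) : IsConvex (conv X) := fun x hx y hy _ hz C hC =>
  hC.1 x (hx C hC) y (hy C hC) hz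

theorem conv_subset {X C : Set ℍ} (hC : IsConvex C) (h : X ⊆ C) : conv X ⊆ C :=
  fun _ hz => hz C ⟨hC, h⟩

theorem isConvex_lin_nonneg (α β γ : ℝ) : IsConvex {z | 0 ≤ lin α β γ z} := by
  intro x hx y hy z hz
  obtain ⟨l, m, hl, hm, h⟩ := mem_segment_iff.1 hz
  simp only [Set.mem_ofPred_eq] at *
  rw [h.lin]
  positivity

/-- The sign of `c` matters: the weights add up to at most 1, not exactly 1. -/
theorem isConvex_lin_le (α β γ : ℝ) {c : ℝ} (hc : 0 ≤ c) : IsConvex {z | lin α β γ z ≤ c} := by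
  intro x hx y hy z hz
  obtain ⟨l, m, hl, hm, h⟩ := mem_segment_iff.1 hz
  simp only [Set.mem_ofPred_eq] at *
  rw [h.lin]
  nlinarith [mul_le_mul_of_nonneg_left hx hl, mul_le_mul_of_nonneg_left hy hm,
    h.add_le_one hl hm]

theorem isConvex_closedBall (p : ℍ) {r : ℝ} (hr : 0 ≤ r) : IsConvex (Metric.closedBall p r) := by
  have : Metric.closedBall p r = {z | lin (vt p) (-vu p) (-vs p) z ≤ Real.cosh r} := by
    ext z
    rw [Metric.mem_closedBall, Set.mem_ofPred_eq, dist_comm, ← abs_of_nonneg (dist_nonneg (x := p)),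
      ← abs_of_nonneg hr, ← Real.cosh_le_cosh, cosh_dist_eq, abs_of_nonneg hr, lin]
    ring_nf
  rw [this]
  exact isConvex_lin_le _ _ _ (Real.cosh_pos r).le

theorem conv_subset_closedBall {X : Set ℍ} {p : ℍ} {r : ℝ} (hr : 0 ≤ r)
    (h : ∀ x ∈ X, dist x p ≤ r) : conv X ⊆ Metric.closedBall p r :=
  conv_subset (isConvex_closedBall p hr) h

/-- Convexity of balls is used twice, once for each of the two points. -/
theorem diam_conv_le {X : Set ℍ} {r : ℝ} (hr : 0 ≤ r) (h : ∀ x ∈ X, ∀ y ∈ X, dist x y ≤ r) :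
    Metric.diam (conv X) ≤ r := by
  refine Metric.diam_le_of_forall_dist_le hr fun x hx y hy => ?_
  refine conv_subset_closedBall hr (fun z hz => ?_) hx
  rw [dist_comm]
  exact conv_subset_closedBall hr (fun w hw => h w hw z hz) hy

/-! ### Vertices of a convex polygon in cyclic order -/

theorem Comb.eq_right {m : ℝ} {z x y : ℍ} (h : Comb 0 m z x y) (hm : 0 ≤ m) : z = y := by
  have h1 : m = 1 := by
    have := h.sq
    nlinarith
  subst h1
  exact ext_vec (by simp [h.t]) (by simp [h.u]) (by simp [h.s])

theorem exists_comb_of_mem_openSegment {x y z : ℍ} (h : z ∈ openSegment x y) :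
    ∃ l m, 0 < l ∧ 0 < m ∧ Comb l m z x y := by
  obtain ⟨hz, hne⟩ := h
  obtain ⟨l, m, hl, hm, hc⟩ := mem_segment_iff.1 hz
  refine ⟨l, m, hl.lt_of_ne' ?_, hm.lt_of_ne' ?_, hc⟩
  · rintro rfl
    exact hne (Or.inr (hc.eq_right hm))
  · rintro rfl
    exact hne (Or.inl (hc.swap.eq_right hl))

/-- The signs of the two coefficients tell which point lies between the others; both negative is
excluded by positive time coordinates. -/
theorem mem_segment_of_det3_eq_zero {x y z : ℍ} (hxy : x ≠ y) (h : det3 x y z = 0) :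
    z ∈ segment x y ∨ x ∈ segment z y ∨ y ∈ segment z x := by
  obtain ⟨l, m, hc⟩ := exists_comb_of_det3_eq_zero hxy h
  have hx := vt_pos x
  have hy := vt_pos y
  have hz := vt_pos z
  have ht := hc.t
  rcases lt_or_ge l 0 with hl | hl <;> rcases lt_or_ge m 0 with hm | hm
  · nlinarith
  · have hm' : 0 < m := by
      by_contra h0
      nlinarith
    refine Or.inr (Or.inr (mem_segment_iff.2 ⟨1 / m, -l / m, by positivity,
      div_nonneg (by linarith) hm, ?_, ?_, ?_⟩)) <;>
      simp only [hc.t, hc.u, hc.s] <;> field_simp <;> ring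
  · have hl' : 0 < l := by
      by_contra h0
      nlinarith
    refine Or.inr (Or.inl (mem_segment_iff.2 ⟨1 / l, -m / l, by positivity,
      div_nonneg (by linarith) hl, ?_, ?_, ?_⟩)) <;>
      simp only [hc.t, hc.u, hc.s] <;> field_simp <;> ring
  · exact Or.inl (hc.mem_segment hl hm)

theorem lin_ne_zero {α β γ : ℝ} (h : α ^ 2 < β ^ 2 + γ ^ 2) {x y z : ℍ} (hx : lin α β γ x = 0)
    (hy : lin α β γ y = 0) (hd : det3 x y z ≠ 0) : lin α β γ z ≠ 0 := by
  intro hz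
  unfold lin at hx hy hz
  unfold det3 lin at hd
  have ha : α = 0 := by
    apply (mul_eq_zero.1 _).resolve_right hd
    linear_combination (vu y * vs z - vs y * vu z) * hx + (vs x * vu z - vu x * vs z) * hy +
      (vu x * vs y - vs x * vu y) * hz
  have hb : β = 0 := by
    apply (mul_eq_zero.1 _).resolve_right hd
    linear_combination (vs y * vt z - vt y * vs z) * hx + (vt x * vs z - vs x * vt z) * hy +
      (vs x * vt y - vt x * vs y) * hz
  have hg : γ = 0 := by
    apply (mul_eq_zero.1 _).resolve_right hd
    linear_combination (vt y * vu z - vu y * vt z) * hx + (vu x * vt z - vt x * vu z) * hy +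
      (vt x * vu y - vu x * vt y) * hz
  subst ha hb hg
  simp at h

section Polygon

variable {n : ℕ} {v : ZMod n → ℍ} {P : Set ℍ}

theorem IsPolygon.notMem_segment (h : IsPolygon n v P) {i j m : ZMod n} (hj : j ≠ i) (hm : m ≠ i) :
    v i ∉ segment (v j) (v m) := fun hs => by
  have mem : ∀ a, a ≠ i → v a ∈ conv (Set.range v \ {v i}) := fun a ha =>
    subset_conv _ ⟨⟨a, rfl⟩, fun h' => ha (h.injective h')⟩
  exact h.vertex i (isConvex_conv _ _ (mem j hj) _ (mem m hm) hs)

theorem IsPolygon.det3_ne_zero (h : IsPolygon n v P) {i j m : ZMod n} (hij : i ≠ j) (him : i ≠ m)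
    (hjm : j ≠ m) : det3 (v i) (v j) (v m) ≠ 0 := fun h0 => by
  rcases mem_segment_of_det3_eq_zero (fun h' => hij (h.injective h')) h0 with h1 | h1 | h1
  · exact h.notMem_segment him hjm h1
  · exact h.notMem_segment him.symm hij.symm h1
  · exact h.notMem_segment hjm.symm hij h1

theorem IsPolygon.mem (h : IsPolygon n v P) (i : ZMod n) : v i ∈ P := by
  rw [h.eq_conv]
  exact subset_conv _ ⟨i, rfl⟩

/-- The functional of the supporting line through a side is proportional to the side determinant,
nonnegative on `P`, and nonzero at the other vertices. -/
theorem IsPolygon.det3_mul_pos (h : IsPolygon n v P) (h1 : (1 : ZMod n) ≠ 0) {i j m : ZMod n}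
    (hj : j ≠ i) (hj' : j ≠ i + 1) (hm : m ≠ i) (hm' : m ≠ i + 1) :
    0 < det3 (v i) (v (i + 1)) (v j) * det3 (v i) (v (i + 1)) (v m) := by
  obtain ⟨l, hl, hi, hi'⟩ := h.side i
  obtain ⟨α, β, γ, hd, rfl, hP, -⟩ := isSupportingLine_iff.1 hl
  have hii : i ≠ i + 1 := fun h' => h1 (by simpa using h'.symm)
  have dj := h.det3_ne_zero hii hj.symm hj'.symm
  have dm := h.det3_ne_zero hii hm.symm hm'.symm
  have ej := (hP _ (h.mem j)).lt_of_ne' (lin_ne_zero hd hi hi' dj)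
  have em := (hP _ (h.mem m)).lt_of_ne' (lin_ne_zero hd hi hi' dm)
  have key := lin_mul_det3 hi hi' (v j) (v m)
  have : 0 < lin α β γ (v j) * (det3 (v i) (v (i + 1)) (v j) * det3 (v i) (v (i + 1)) (v m)) := by
    rw [show lin α β γ (v j) * (det3 (v i) (v (i + 1)) (v j) * det3 (v i) (v (i + 1)) (v m)) =
      lin α β γ (v m) * det3 (v i) (v (i + 1)) (v j) ^ 2 from by
        linear_combination (det3 (v i) (v (i + 1)) (v j)) * key]
    exact mul_pos em (by positivity)
  exact pos_of_mul_pos_right this ej.le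

/-- The side determinants of a convex polygon all have the same sign. -/
theorem IsPolygon.det3_side_pos (h : IsPolygon n v P) (h1 : (1 : ZMod n) ≠ 0)
    (h2 : (2 : ZMod n) ≠ 0) (a : ℕ) (j : ZMod n) (hj : j ≠ a) (hj' : j ≠ a + 1) :
    0 < det3 (v 0) (v 1) (v 2) * det3 (v a) (v (a + 1)) (v j) := by
  have h21 : ∀ i : ZMod n, i + 1 + 1 ≠ i := fun i h' => h2 (by
    rw [add_assoc, add_eq_left] at h'
    rw [← h']
    norm_num)
  have h11 : ∀ i : ZMod n, i + 1 ≠ i := fun i h' => h1 (by simpa using h')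
  induction a generalizing j with
  | zero =>
    have := h.det3_mul_pos (i := 0) (j := 2) (m := j) h1 h2 (by
      intro h'
      exact h11 1 (by simpa [one_add_one_eq_two] using h')) (by simpa using hj) (by simpa using hj')
    simpa using this
  | succ a ih =>
    push_cast at hj hj' ⊢
    have e1 := ih (a + 1 + 1) (h21 _) (h11 _)
    have e2 := h.det3_mul_pos (i := a + 1) (j := a) (m := j) h1 (h11 _).symm (h21 _).symm hj hj'
    -- Consecutive sides share the triple `a, a + 1, a + 2`, through which the sign propagates.
    rw [← det3_cycle] at e2
    set x := det3 (v a) (v (a + 1)) (v (a + 1 + 1))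
    set y := det3 (v 0) (v 1) (v 2)
    set z := det3 (v (a + 1)) (v (a + 1 + 1)) (v j)
    have e3 : 0 < x ^ 2 * (y * z) := by
      have := mul_pos e1 e2
      linarith
    exact pos_of_mul_pos_right e3 (sq_nonneg x)

/-- Cyclic order is encoded by unreduced naturals `a < b < c < a + n`, leaving index conditions to
linear arithmetic. -/
theorem natCast_ne_of_lt_of_lt {a b : ℕ} (h : a < b) (h' : b < a + n) : (b : ZMod n) ≠ a := by
  intro he
  rw [ZMod.natCast_eq_natCast_iff] at he
  have := (Nat.modEq_iff_dvd' h.le).1 he.symm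
  have := Nat.le_of_dvd (by omega) this
  omega

/-- The vertices of a convex polygon are in strictly convex position, in cyclic order. -/
theorem IsPolygon.det3_pos (h : IsPolygon n v P) (hn : 2 < n) {a b c : ℕ} (hab : a < b)
    (hbc : b < c) (hc : c < a + n) :
    0 < det3 (v 0) (v 1) (v 2) * det3 (v a) (v b) (v c) := by
  have h1 : (1 : ZMod n) ≠ 0 := by
    simpa using natCast_ne_of_lt_of_lt (n := n) (a := 0) (b := 1) (by omega) (by omega)
  have h2 : (2 : ZMod n) ≠ 0 := by
    simpa using natCast_ne_of_lt_of_lt (n := n) (a := 0) (b := 2) (by omega) (by omega)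
  have hs : ∀ i j : ℕ, (j : ZMod n) ≠ i → (j : ZMod n) ≠ (i + 1 : ℕ) →
      0 < det3 (v 0) (v 1) (v 2) * det3 (v i) (v ((i + 1 : ℕ))) (v j) := fun i j hj hj' => by
    push_cast at hj' ⊢
    exact h.det3_side_pos h1 h2 i j hj hj'
  induction c, hbc using Nat.le_induction with
  | base =>
    rw [det3_cycle (v a)]
    exact hs b a (natCast_ne_of_lt_of_lt hab (by omega)).symm
      (natCast_ne_of_lt_of_lt (by omega) (by omega)).symm
  | succ c hbc ih =>
    have ih := ih (by omega)
    rcases (Nat.succ_le_of_lt hab).eq_or_lt with rfl | hlt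
    · exact hs a (c + 1) (natCast_ne_of_lt_of_lt (by omega) (by omega))
        (natCast_ne_of_lt_of_lt (by omega) (by omega))
    have e1 := hs a b (natCast_ne_of_lt_of_lt (by omega) (by omega))
        (natCast_ne_of_lt_of_lt (by omega) (by omega))
    have e2 := hs a c (natCast_ne_of_lt_of_lt (by omega) (by omega))
        (natCast_ne_of_lt_of_lt (by omega) (by omega))
    have e3 := hs a (c + 1) (natCast_ne_of_lt_of_lt (by omega) (by omega))
        (natCast_ne_of_lt_of_lt (by omega) (by omega))
    have e4 := hs c a (natCast_ne_of_lt_of_lt (by omega) (by omega)).symm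
        (natCast_ne_of_lt_of_lt (by omega) (by omega)).symm
    rw [← det3_cycle (v a)] at e4
    -- With `v a` fixed, the Plücker relation writes `[a+1, c] [b, c+1]` as `[a+1, b] [c, c+1] +
    -- [a+1, c+1] [b, c]`. Both summands are positive by the side signs and induction.
    have key := det3_pluecker (v a) (v (a + 1 : ℕ)) (v b) (v c) (v (c + 1 : ℕ))
    set e := det3 (v 0) (v 1) (v 2)
    have e5 := mul_pos e1 e4
    have e6 := mul_pos e3 ih
    refine pos_of_mul_pos_right (a := e * det3 (v a) (v (a + 1 : ℕ)) (v c)) ?_ e2.le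
    linear_combination e5 + e6 + e ^ 2 * key

theorem IsPolygon.det3_nonneg (h : IsPolygon n v P) (hn : 2 < n) {a b c : ℕ} (hab : a ≤ b)
    (hbc : b ≤ c) (hc : c ≤ a + n) :
    0 ≤ det3 (v 0) (v 1) (v 2) * det3 (v a) (v b) (v c) := by
  rcases hab.eq_or_lt with rfl | hab
  · rw [det3_cycle (v a), det3_self_left, mul_zero]
  rcases hbc.eq_or_lt with rfl | hbc
  · rw [det3_self, mul_zero]
  rcases hc.eq_or_lt with rfl | hc
  · rw [Nat.cast_add, ZMod.natCast_self, add_zero, det3_self_left, mul_zero]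
  exact (h.det3_pos hn hab hbc hc).le

end Polygon

/-- The diagonals of a convex quadrangle cross. -/
theorem exists_mem_segment_inter {e : ℝ} {A C S T : ℍ} (h1 : 0 < e * det3 A C T)
    (h2 : 0 < e * det3 C S T) (h3 : 0 < e * det3 A S T) (h4 : 0 < e * det3 A C S) :
    ∃ o, o ∈ segment A S ∧ o ∈ segment C T ∧ o ≠ S := by
  -- The linear relation among `A`, `C`, `S`, `T` has determinants as coefficients. Moving `C` and
  -- `T` to the other side gives one vector that lies on both diagonals.
  obtain ⟨o, q, hq, ho⟩ := exists_comb h2 h1 A S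
  have ho' : Comb (q * (e * det3 A S T)) (q * (e * det3 A C S)) o C T := by
    refine ⟨?_, ?_, ?_⟩
    · rw [ho.t]
      unfold det3 lin
      ring
    · rw [ho.u]
      unfold det3 lin
      ring
    · rw [ho.s]
      unfold det3 lin
      ring
  refine ⟨o, ho.mem_segment (by positivity) (by positivity),
    ho'.mem_segment (by positivity) (by positivity), ?_⟩
  rintro rfl
  have := ho'.det3 C T
  rw [det3_self_left, det3_self, mul_zero, mul_zero, add_zero] at this
  rw [det3_swap_right, this] at h2
  simp at h2

/-! ### The bounds for the ratio of diameter and width -/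

theorem ne_of_mem_openSegment {x y z : ℍ} (h : z ∈ openSegment x y) : x ≠ y := by
  rintro rfl
  obtain ⟨h1, h2⟩ := h
  change dist x z + dist z x = dist x x at h1
  rw [dist_self, dist_comm z x] at h1
  exact h2 (Or.inl (dist_eq_zero.1 (by linarith : dist x z = 0)).symm)

theorem cosh_le_cosh_of_le {a b : ℝ} (ha : 0 ≤ a) (h : a ≤ b) : Real.cosh a ≤ Real.cosh b := by
  rwa [Real.cosh_le_cosh, abs_of_nonneg ha, abs_of_nonneg (ha.trans h)]

/-- Interior points of a segment are nearer to any point than one of the end points. -/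
theorem dist_lt_or_of_mem_openSegment {x y t : ℍ} (ht : t ∈ openSegment x y) (z : ℍ) :
    dist z t < dist z x ∨ dist z t < dist z y := by
  obtain ⟨a, b, ha, hb, hc⟩ := exists_comb_of_mem_openSegment ht
  by_contra! hcon
  have e1 := hc.cosh_dist z
  have e2 := hc.add_lt_one ha hb (ne_of_mem_openSegment ht)
  have e3 := mul_le_mul_of_nonneg_left (cosh_le_cosh_of_le dist_nonneg hcon.1) ha.le
  have e4 := mul_le_mul_of_nonneg_left (cosh_le_cosh_of_le dist_nonneg hcon.2) hb.le
  nlinarith [Real.cosh_pos (dist z t)]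

/-- With `o` the crossing point of the altitudes, the distance is at most `2 * w - dist o S - dist o
T`, and `o ≠ S` makes this strict. -/
theorem IsPolygon.dist_lt_of_le {k : ℕ} {v : ZMod (2 * k + 1) → ℍ} {P : Set ℍ}
    (h : IsPolygon (2 * k + 1) v P) {t : ZMod (2 * k + 1) → ℍ} {w : ℝ}
    (ht : ∀ i, t i ∈ openSegment (v (i + k)) (v (i + k + 1))) (hw : ∀ i, dist (v i) (t i) = w)
    {a m : ℕ} (hm : 1 ≤ m) (hmk : m ≤ k) :
    dist (v (a : ℕ)) (v (a + m : ℕ)) < 2 * w := by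
  have hn : 2 < 2 * k + 1 := by omega
  obtain ⟨l, r, hl, hr, hc⟩ := exists_comb_of_mem_openSegment (ht (a : ℕ))
  obtain ⟨l', r', hl', hr', hc'⟩ := exists_comb_of_mem_openSegment (ht (a + m : ℕ))
  have pos : ∀ {x y z : ℕ}, x < y → y < z → z < x + (2 * k + 1) →
    0 < det3 (v 0) (v 1) (v 2) * det3 (v x) (v y) (v z) := fun h1 h2 h3 => h.det3_pos hn h1 h2 h3
  -- Weak inequalities are needed since vertices may coincide: for `m = k`, `a + m` is `a + k` and
  -- `a + m + k + 1` is `a` modulo `n`. Each sum below keeps one strict term.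
  have nonneg : ∀ {x y z : ℕ}, x ≤ y → y ≤ z → z ≤ x + (2 * k + 1) →
    0 ≤ det3 (v 0) (v 1) (v 2) * det3 (v x) (v y) (v z) := fun h1 h2 h3 =>
      h.det3_nonneg hn h1 h2 h3
  norm_cast at hc hc'
  set e := det3 (v 0) (v 1) (v 2)
  set S := t (a : ℕ)
  set T := t (a + m : ℕ)
  have hS : ∀ p q, e * det3 p q S =
      l * (e * det3 p q (v (a + k : ℕ))) + r * (e * det3 p q (v (a + k + 1 : ℕ))) := fun p q => by
    rw [hc.det3]
    ring
  have hT : ∀ p q, e * det3 p q T = l' * (e * det3 p q (v (a + m + k : ℕ))) +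
      r' * (e * det3 p q (v (a + m + k + 1 : ℕ))) := fun p q => by
    rw [hc'.det3]
    ring
  have hS' : ∀ p q, e * det3 p S q =
      l * (e * det3 p (v (a + k : ℕ)) q) + r * (e * det3 p (v (a + k + 1 : ℕ)) q) := fun p q => by
    rw [← det3_cycle, hS, det3_cycle q, det3_cycle q]
  obtain ⟨o, ho1, ho2, ho3⟩ := exists_mem_segment_inter (e := e) (A := v (a : ℕ))
    (C := v (a + m : ℕ)) (S := S) (T := T)
    (by
      rw [hT]
      exact add_pos_of_pos_of_nonneg (mul_pos hl' (pos (by omega) (by omega) (by omega)))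
        (mul_nonneg hr'.le (nonneg (by omega) (by omega) (by omega))))
    (by
      rw [hS', hT, hT]
      have e1 := mul_nonneg hl'.le (nonneg (x := a + m) (y := a + k) (z := a + m + k)
        (by omega) (by omega) (by omega))
      have e2 := mul_nonneg hr'.le (nonneg (x := a + m) (y := a + k) (z := a + m + k + 1)
        (by omega) (by omega) (by omega))
      have e3 := mul_nonneg hl'.le (nonneg (x := a + m) (y := a + k + 1) (z := a + m + k)
        (by omega) (by omega) (by omega))
      have e4 := mul_pos hr' (pos (x := a + m) (y := a + k + 1) (z := a + m + k + 1)
        (by omega) (by omega) (by omega))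
      exact add_pos_of_nonneg_of_pos (mul_nonneg hl.le (add_nonneg e1 e2))
        (mul_pos hr (add_pos_of_nonneg_of_pos e3 e4)))
    (by
      rw [hS', hT, hT]
      have e1 := mul_pos hl' (pos (x := a) (y := a + k) (z := a + m + k)
        (by omega) (by omega) (by omega))
      have e2 := mul_nonneg hr'.le (nonneg (x := a) (y := a + k) (z := a + m + k + 1)
        (by omega) (by omega) (by omega))
      have e3 := mul_nonneg hl'.le (nonneg (x := a) (y := a + k + 1) (z := a + m + k)
        (by omega) (by omega) (by omega))
      have e4 := mul_nonneg hr'.le (nonneg (x := a) (y := a + k + 1) (z := a + m + k + 1)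
        (by omega) (by omega) (by omega))
      exact add_pos_of_pos_of_nonneg (mul_pos hl (add_pos_of_pos_of_nonneg e1 e2))
        (mul_nonneg hr.le (add_nonneg e3 e4)))
    (by
      rw [hS]
      exact add_pos_of_nonneg_of_pos
        (mul_nonneg hl.le (nonneg (by omega) (by omega) (by omega)))
        (mul_pos hr (pos (by omega) (by omega) (by omega))))
  change dist _ o + dist o S = dist _ S at ho1
  change dist _ o + dist o T = dist _ T at ho2
  rw [hw] at ho1 ho2
  have e1 := dist_triangle_right (v (a : ℕ)) (v (a + m : ℕ)) o
  have e2 := dist_pos.2 ho3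
  have e3 : 0 ≤ dist o T := dist_nonneg
  linarith

theorem IsPolygon.dist_lt {k : ℕ} {v : ZMod (2 * k + 1) → ℍ} {P : Set ℍ}
    (h : IsPolygon (2 * k + 1) v P) {t : ZMod (2 * k + 1) → ℍ} {w : ℝ} (hw0 : 0 < w)
    (ht : ∀ i, t i ∈ openSegment (v (i + k)) (v (i + k + 1))) (hw : ∀ i, dist (v i) (t i) = w)
    (i j : ZMod (2 * k + 1)) : dist (v i) (v j) < 2 * w := by
  wlog hij : i.val ≤ j.val generalizing i j
  · rw [dist_comm]
    exact this j i (le_of_not_ge hij)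
  have hi : ((i.val : ℕ) : ZMod (2 * k + 1)) = i := ZMod.natCast_zmod_val i
  have hj : ((j.val : ℕ) : ZMod (2 * k + 1)) = j := ZMod.natCast_zmod_val j
  have hi' := ZMod.val_lt i
  have hj' := ZMod.val_lt j
  generalize i.val = a at *
  generalize j.val = b at *
  subst hi hj
  rcases hij.eq_or_lt with rfl | hlt
  · simpa using hw0
  rcases le_or_gt (b - a) k with hk | hk
  · have := h.dist_lt_of_le ht hw (a := a) (m := b - a) (by omega) hk
    rwa [show a + (b - a) = b by omega] at this
  -- More than `k` steps one way round are at most `k` steps the other way.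
  · have := h.dist_lt_of_le ht hw (a := b) (m := a + (2 * k + 1) - b) (by omega) (by omega)
    rw [show b + (a + (2 * k + 1) - b) = a + (2 * k + 1) by omega, Nat.cast_add,
      ZMod.natCast_self, add_zero] at this
    rwa [dist_comm]

theorem IsPolygon.diam_bounds {k : ℕ} {v : ZMod (2 * k + 1) → ℍ} {P : Set ℍ}
    (h : IsPolygon (2 * k + 1) v P) {w : ℝ}
    (hv : ∀ i, Metric.infDist (v i) (segment (v (i + k)) (v (i + k + 1))) = w ∧
      ∃ l t, IsLine l ∧ v (i + k) ∈ l ∧ v (i + k + 1) ∈ l ∧ IsProjection (v i) l t ∧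
        t ∈ openSegment (v (i + k)) (v (i + k + 1))) :
    0 < w ∧ w < Metric.diam P ∧ Metric.diam P < 2 * w := by
  choose hinf l t hl hl1 hl2 hpr ht using hv
  have hseg : ∀ i, segment (v (i + k)) (v (i + k + 1)) ⊆ l i := fun i z hz => by
    have h1 := hl1 i
    have h2 := hl2 i
    obtain ⟨α, β, γ, -, he⟩ := isLine_iff.1 (hl i)
    rw [he] at h1 h2 ⊢
    obtain ⟨a, b, -, -, hc⟩ := mem_segment_iff.1 hz
    simp only [Set.mem_ofPred_eq] at h1 h2 ⊢
    rw [hc.lin, h1, h2]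
    simp
  have hw : ∀ i, dist (v i) (t i) = w := fun i => by
    rw [← hinf i]
    refine le_antisymm ?_ (Metric.infDist_le_dist_of_mem (ht i).1)
    rw [Metric.le_infDist ⟨_, (ht i).1⟩]
    exact fun {z} hz => (hpr i).2 z (hseg i hz)
  have hw0 : 0 < w := by
    refine (hw 0 ▸ dist_nonneg : 0 ≤ w).lt_of_ne' fun h0 => ?_
    have h1 := dist_eq_zero.1 ((hw 0).trans h0)
    have h2 := (ht 0).1
    have h3 := ne_of_mem_openSegment (ht 0)
    rw [← h1] at h2
    -- For `k = 0` there is one vertex and the opposite side has no relative interior.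
    have hk : k ≠ 0 := by
      rintro rfl
      have : Subsingleton (ZMod (2 * 0 + 1)) := (inferInstance : Subsingleton (ZMod 1))
      exact h3 (congrArg v (Subsingleton.elim _ _))
    refine h.notMem_segment ?_ ?_ h2
    · simpa using natCast_ne_of_lt_of_lt (n := 2 * k + 1) (a := 0) (b := k) (by omega) (by omega)
    · simpa using natCast_ne_of_lt_of_lt (n := 2 * k + 1) (a := 0) (b := k + 1)
        (by omega) (by omega)
  have hb : Bornology.IsBounded P := h.convexBody.2.1.isBounded
  refine ⟨hw0, ?_, ?_⟩
  · rw [← hw 0]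
    rcases dist_lt_or_of_mem_openSegment (ht 0) (v 0) with h1 | h1 <;>
      exact h1.trans_le (Metric.dist_le_diam_of_mem hb (h.mem _) (h.mem _))
  have hd := h.dist_lt hw0 ht hw
  obtain ⟨⟨i, j⟩, hij⟩ := Finite.exists_max
    (fun q : ZMod (2 * k + 1) × ZMod (2 * k + 1) => dist (v q.1) (v q.2))
  rw [h.eq_conv]
  refine (diam_conv_le dist_nonneg ?_).trans_lt (hd i j)
  rintro _ ⟨a, rfl⟩ _ ⟨b, rfl⟩
  exact hij (a, b)

/-! ### Distances to lines and the minimal width -/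

theorem isSupportingLine_iff_normalized {K l : Set ℍ} :
    IsSupportingLine K l ↔ ∃ α β γ : ℝ, β ^ 2 + γ ^ 2 = α ^ 2 + 1 ∧ l = {z | lin α β γ z = 0} ∧
      (∀ z ∈ K, 0 ≤ lin α β γ z) ∧ ∃ z ∈ K, lin α β γ z = 0 := by
  rw [isSupportingLine_iff]
  constructor
  · rintro ⟨α, β, γ, h, rfl, hK, p, hpK, hp⟩
    have hq : 0 < (√(β ^ 2 + γ ^ 2 - α ^ 2))⁻¹ := inv_pos.2 (Real.sqrt_pos.2 (by linarith))
    have hq2 : (√(β ^ 2 + γ ^ 2 - α ^ 2))⁻¹ ^ 2 * (β ^ 2 + γ ^ 2 - α ^ 2) = 1 := by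
      rw [inv_pow, Real.sq_sqrt (by linarith), inv_mul_cancel₀ (by linarith)]
    generalize (√(β ^ 2 + γ ^ 2 - α ^ 2))⁻¹ = q at hq hq2
    have e : ∀ z, lin (q * α) (q * β) (q * γ) z = q * lin α β γ z := fun z => by
      unfold lin
      ring
    refine ⟨q * α, q * β, q * γ, by linear_combination hq2, ?_, fun z hz => ?_, p, hpK, ?_⟩
    · ext z
      simp [e, hq.ne']
    · rw [e]
      exact mul_nonneg hq.le (hK z hz)
    · rw [e, hp, mul_zero]
  · rintro ⟨α, β, γ, h, h'⟩
    exact ⟨α, β, γ, by linarith, h'⟩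

/-- For a unit normal, `|lin α β γ p|` is `sinh` of the distance from `p` to the line. The lower
bound is the Gram inequality for the normal, `p` and `z`. -/
theorem abs_lin_le_sinh_dist {α β γ : ℝ} (h : β ^ 2 + γ ^ 2 = α ^ 2 + 1) {z : ℍ}
    (hz : lin α β γ z = 0) (p : ℍ) : |lin α β γ p| ≤ Real.sinh (dist p z) := by
  have e := cosh_dist_eq p z
  have hp := vec_sq p
  have hzz := vec_sq z
  apply abs_le_of_sq_le_sq _ (Real.sinh_nonneg_iff.2 dist_nonneg)
  rw [Real.sinh_sq, e]
  have hN : α ^ 2 - β ^ 2 - γ ^ 2 = -1 := by linarith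
  have gram : (α * (vu p * vs z - vs p * vu z) - β * (vs p * vt z - vt p * vs z) -
      γ * (vt p * vu z - vu p * vt z)) ^ 2 =
      (vt z ^ 2 - vu z ^ 2 - vs z ^ 2) * ((vt p ^ 2 - vu p ^ 2 - vs p ^ 2) *
        (α ^ 2 - β ^ 2 - γ ^ 2) - lin α β γ p ^ 2) -
      (vt p * vt z - vu p * vu z - vs p * vs z) ^ 2 * (α ^ 2 - β ^ 2 - γ ^ 2) +
      2 * (vt p * vt z - vu p * vu z - vs p * vs z) * lin α β γ p * lin α β γ z -
      (vt p ^ 2 - vu p ^ 2 - vs p ^ 2) * lin α β γ z ^ 2 := by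
    unfold lin
    ring
  rw [hp, hzz, hN, hz] at gram
  nlinarith [sq_nonneg (α * (vu p * vs z - vs p * vu z) - β * (vs p * vt z - vt p * vs z) -
      γ * (vt p * vu z - vu p * vt z))]

/-- The foot is `p + x N` normalised, where `N = (α, -β, -γ)` is the unit normal and `x = lin α β γ
p`. -/
theorem exists_foot {α β γ : ℝ} (h : β ^ 2 + γ ^ 2 = α ^ 2 + 1) (p : ℍ) :
    ∃ q, lin α β γ q = 0 ∧ Real.sinh (dist p q) = |lin α β γ p| := by
  have hp := vec_sq p
  have ht := vt_pos p
  obtain ⟨x, hx⟩ : ∃ x, x = lin α β γ p := ⟨_, rfl⟩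
  have hx' : x = α * vt p + β * vu p + γ * vs p := hx
  have hpos : 0 < vt p + x * α := by
    have h1 : (α * (β * vu p + γ * vs p)) ^ 2 < ((1 + α ^ 2) * vt p) ^ 2 := by
      have h2 : (β * vu p + γ * vs p) ^ 2 ≤ (α ^ 2 + 1) * (vt p ^ 2 - 1) := by
        rw [← h, ← hp]
        nlinarith [sq_nonneg (β * vs p - γ * vu p)]
      have h3 := mul_le_mul_of_nonneg_left h2 (sq_nonneg α)
      nlinarith [mul_pos ht ht, sq_nonneg α, sq_nonneg (α * vt p), sq_nonneg (α ^ 2)]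
    have h4 := (abs_lt_of_sq_lt_sq' h1 (by positivity)).1
    rw [hx']
    linarith
  have hsq : (vt p + x * α) ^ 2 - (vu p - x * β) ^ 2 - (vs p - x * γ) ^ 2 = 1 + x ^ 2 := by
    linear_combination hp - 2 * x * hx' - x ^ 2 * h
  obtain ⟨z, q, hq, h1, h2, h3⟩ := exists_vec_normalize (t := vt p + x * α) (u := vu p - x * β)
    (s := vs p - x * γ) (by rw [hsq]; positivity) hpos
  have hz := vec_sq z
  rw [h1, h2, h3] at hz
  have hq2 : q ^ 2 * (1 + x ^ 2) = 1 := by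
    rw [← hsq, ← hz]
    ring
  refine ⟨z, ?_, ?_⟩
  · unfold lin
    rw [h1, h2, h3]
    linear_combination -q * hx' - q * x * h
  · rw [← hx, ← sq_eq_sq₀ (Real.sinh_nonneg_iff.2 dist_nonneg) (abs_nonneg x), sq_abs,
      Real.sinh_sq, cosh_dist_eq, h1, h2, h3]
    have e : vt p * (q * (vt p + x * α)) - vu p * (q * (vu p - x * β)) -
        vs p * (q * (vs p - x * γ)) = q * (1 + x ^ 2) := by
      linear_combination q * hp - q * x * hx'
    rw [e]
    linear_combination (1 + x ^ 2) * hq2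

theorem continuous_vt : Continuous vt := by
  have := UpperHalfPlane.continuous_re
  have := UpperHalfPlane.continuous_im
  unfold vt
  exact Continuous.div (by fun_prop) (by fun_prop) fun z => by
    have := z.im_pos
    positivity

theorem continuous_vu : Continuous vu := by
  have := UpperHalfPlane.continuous_re
  have := UpperHalfPlane.continuous_im
  unfold vu
  exact Continuous.div (by fun_prop) (by fun_prop) fun z => by
    have := z.im_pos
    positivity

theorem continuous_vs : Continuous vs := by
  have := UpperHalfPlane.continuous_re
  have := UpperHalfPlane.continuous_im
  unfold vs
  exact Continuous.div (by fun_prop) (by fun_prop) fun z => z.im_pos.ne'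

theorem continuous_lin (α β γ : ℝ) : Continuous (lin α β γ) := by
  have := continuous_vt
  have := continuous_vu
  have := continuous_vs
  unfold lin
  fun_prop

theorem setDist_le_dist {A B : Set ℍ} {x y : ℍ} (hx : x ∈ A) (hy : y ∈ B) :
    setDist A B ≤ dist x y :=
  csInf_le ⟨0, by rintro _ ⟨x, -, y, -, rfl⟩; exact dist_nonneg⟩ ⟨x, hx, y, hy, rfl⟩

/-- At a point `q` of `K` farthest from the line, the perpendicular to the altitude of `q` supports
`K`; on it `lin α β γ z = x * cosh (dist q z) ≥ x`, with `x` the maximum of the functional. -/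
theorem le_width {K : Set ℍ} (hK : IsCompact K) {α β γ D : ℝ} (h : β ^ 2 + γ ^ 2 = α ^ 2 + 1)
    (hl : IsSupportingLine K {z | lin α β γ z = 0}) (hpos : ∀ z ∈ K, 0 ≤ lin α β γ z) {p : ℍ}
    (hp : p ∈ K) (hD : Real.sinh D ≤ lin α β γ p) : D ≤ width K {z | lin α β γ z = 0} := by
  obtain ⟨q, hq, hmax⟩ := hK.exists_isMaxOn ⟨p, hp⟩ (continuous_lin α β γ).continuousOn
  have hmax : ∀ z ∈ K, lin α β γ z ≤ lin α β γ q := hmax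
  obtain ⟨x, hx⟩ : ∃ x, x = lin α β γ q := ⟨_, rfl⟩
  have hx' : x = α * vt q + β * vu q + γ * vs q := hx
  have hx0 : 0 ≤ x := hx ▸ hpos q hq
  rw [← hx] at hmax
  have hqq := vec_sq q
  have e : ∀ z, lin (x * vt q - α) (-x * vu q - β) (-x * vs q - γ) z =
      x * Real.cosh (dist q z) - lin α β γ z := fun z => by
    rw [cosh_dist_eq]
    unfold lin
    ring
  obtain ⟨r, hr, hr0⟩ := hl.2.1
  have hl' : IsSupportingLine K {z | lin (x * vt q - α) (-x * vu q - β) (-x * vs q - γ) z = 0} := by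
    refine isSupportingLine_iff.2 ⟨_, _, _, ?_, rfl, fun z hz => ?_, q, hq, ?_⟩
    · have : (-x * vu q - β) ^ 2 + (-x * vs q - γ) ^ 2 - (x * vt q - α) ^ 2 = 1 + x ^ 2 := by
        linear_combination h - x ^ 2 * hqq - 2 * x * hx'
      nlinarith
    · rw [e]
      have := hmax z hz
      have := Real.one_le_cosh (dist q z)
      nlinarith
    · rw [e, dist_self, Real.cosh_zero, hx]
      ring
  refine le_trans ?_ (le_csSup ⟨Metric.diam K, ?_⟩ ⟨_, hl', rfl⟩)
  · refine le_csInf ⟨_, r, hr0, q, hl'.2.1.elim fun _ _ => ?_, rfl⟩ ?_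
    · change lin _ _ _ q = 0
      rw [e, dist_self, Real.cosh_zero, hx]
      ring
    · rintro _ ⟨y, hy, z, hz, rfl⟩
      change lin _ _ _ z = 0 at hz
      rw [e] at hz
      have h1 := abs_lin_le_sinh_dist h hy z
      have h2 := le_abs_self (lin α β γ z)
      have h3 := Real.one_le_cosh (dist q z)
      have h4 := hmax p hp
      rw [dist_comm, ← Real.sinh_le_sinh]
      nlinarith
  -- The supremum needs a bound: distances between supporting lines are at most the distance of
  -- contact points.
  · rintro _ ⟨l', hl', rfl⟩
    obtain ⟨y, hy, hy'⟩ := hl'.2.1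
    exact (setDist_le_dist hr0 hy').trans (Metric.dist_le_diam_of_mem hK.isBounded hr hy)

theorem width_le {K : Set ℍ} {α β γ D : ℝ} (h : β ^ 2 + γ ^ 2 = α ^ 2 + 1)
    (hl : IsSupportingLine K {z | lin α β γ z = 0}) (hpos : ∀ z ∈ K, 0 ≤ lin α β γ z)
    (hle : ∀ z ∈ K, lin α β γ z ≤ Real.sinh D) : width K {z | lin α β γ z = 0} ≤ D := by
  refine csSup_le ⟨_, _, hl, rfl⟩ ?_
  rintro _ ⟨l', hl', rfl⟩
  obtain ⟨p, hp, hp'⟩ := hl'.2.1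
  obtain ⟨q, hq, hpq⟩ := exists_foot h p
  refine (setDist_le_dist (x := q) hq hp').trans ?_
  rw [dist_comm, ← Real.sinh_le_sinh, hpq, abs_of_nonneg (hpos p hp)]
  exact hle p hp

theorem minimalWidth_eq {K : Set ℍ} (hK : IsCompact K) {D : ℝ}
    (hle : ∃ α β γ : ℝ, β ^ 2 + γ ^ 2 = α ^ 2 + 1 ∧ (∀ z ∈ K, 0 ≤ lin α β γ z) ∧
      (∃ z ∈ K, lin α β γ z = 0) ∧ ∀ z ∈ K, lin α β γ z ≤ Real.sinh D)
    (hge : ∀ α β γ : ℝ, β ^ 2 + γ ^ 2 = α ^ 2 + 1 → (∀ z ∈ K, 0 ≤ lin α β γ z) →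
      ∃ z ∈ K, Real.sinh D ≤ lin α β γ z) : minimalWidth K = D := by
  obtain ⟨α, β, γ, h, h1, h2, h3⟩ := hle
  have hl : IsSupportingLine K {z | lin α β γ z = 0} :=
    isSupportingLine_iff_normalized.2 ⟨α, β, γ, h, rfl, h1, h2⟩
  have hlow : ∀ r ∈ {r | ∃ l, IsSupportingLine K l ∧ r = width K l}, D ≤ r := by
    rintro _ ⟨l, hl, rfl⟩
    obtain ⟨α, β, γ, h, rfl, h1, h2⟩ := isSupportingLine_iff_normalized.1 hl
    obtain ⟨p, hp, hp'⟩ := hge α β γ h h1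
    exact le_width hK h hl h1 hp hp'
  exact le_antisymm ((csInf_le ⟨D, hlow⟩ ⟨_, hl, rfl⟩).trans (width_le h hl h1 h3))
    (le_csInf ⟨_, _, hl, rfl⟩ hlow)

/-! ### Convex hulls of finite sets -/

/-- The projective chart, in which geodesic segments are straight. -/
noncomputable def klein (z : ℍ) : ℝ × ℝ := (vu z / vt z, vs z / vt z)

theorem klein_injective : Function.Injective klein := by
  intro z w h
  have hz := vt_pos z
  have hw := vt_pos w
  simp only [klein, Prod.mk.injEq] at h
  obtain ⟨hu, hs⟩ := h
  have eu : vu z = vu w / vt w * vt z := by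
    rw [← hu]
    field_simp
  have es : vs z = vs w / vt w * vt z := by
    rw [← hs]
    field_simp
  have h1 := vec_sq z
  have h2 := vec_sq w
  have h3 : vt z ^ 2 = vt w ^ 2 := by
    rw [eu, es] at h1
    field_simp at h1
    have h4 : vt z ^ 2 * (vt w ^ 2 - vu w ^ 2 - vs w ^ 2) = vt w ^ 2 := by linarith
    rwa [h2, mul_one] at h4
  have ht : vt z = vt w := (sq_eq_sq₀ hz.le hw.le).1 h3
  rw [ht] at eu es
  refine ext_vec ht ?_ ?_
  · rw [eu]
    field_simp
  · rw [es]
    field_simp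

theorem Comb.klein {l m : ℝ} {z x y : ℍ} (h : Comb l m z x y) :
    klein z = (l * vt x / vt z) • klein x + (m * vt y / vt z) • klein y := by
  have hx := vt_pos x
  have hy := vt_pos y
  have hz := vt_pos z
  simp only [HypPlane.klein, Prod.smul_mk, Prod.mk_add_mk, smul_eq_mul, Prod.mk.injEq, h.u, h.s]
  constructor <;> field_simp

theorem Comb.klein_add {l m : ℝ} {z x y : ℍ} (h : Comb l m z x y) :
    l * vt x / vt z + m * vt y / vt z = 1 := by
  rw [← add_div, ← h.t, div_self (vt_pos z).ne']

theorem isConvex_preimage_klein {s : Set (ℝ × ℝ)} (hs : Convex ℝ s) :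
    IsConvex (klein ⁻¹' s) := by
  intro x hx y hy z hz
  obtain ⟨l, m, hl, hm, h⟩ := mem_segment_iff.1 hz
  have h1 := vt_pos x
  have h2 := vt_pos y
  have h3 := vt_pos z
  rw [Set.mem_preimage, h.klein]
  exact hs hx hy (by positivity) (by positivity) h.klein_add

/-- Affine weights `a`, `b` in the chart correspond to vector weights `a / vt x`, `b / vt y`, up to
normalisation. -/
theorem IsConvex.image_klein {C : Set ℍ} (hC : IsConvex C) : Convex ℝ (klein '' C) := by
  rw [convex_iff_forall_pos]
  rintro _ ⟨x, hx, rfl⟩ _ ⟨y, hy, rfl⟩ a b ha hb hab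
  have h1 := vt_pos x
  have h2 := vt_pos y
  obtain ⟨z, q, hq, h⟩ := exists_comb (div_pos ha h1) (div_pos hb h2) x y
  have h3 := vt_pos z
  refine ⟨z, hC x hx y hy (h.mem_segment (by positivity) (by positivity)), ?_⟩
  have e := h.klein_add
  rw [h.klein]
  have e1 : q * (a / vt x) * vt x = q * a := by field_simp
  have e2 : q * (b / vt y) * vt y = q * b := by field_simp
  rw [e1, e2] at e ⊢
  have e3 : vt z = q := by
    field_simp at e
    rw [← e, hab, mul_one]
  rw [e3, mul_div_cancel_left₀ _ hq.ne', mul_div_cancel_left₀ _ hq.ne']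

theorem conv_eq_preimage (X : Set ℍ) : conv X = klein ⁻¹' convexHull ℝ (klein '' X) := by
  apply Set.Subset.antisymm
  · exact conv_subset (isConvex_preimage_klein (convex_convexHull ℝ _)) fun x hx =>
      subset_convexHull ℝ _ ⟨x, hx, rfl⟩
  · intro z hz
    obtain ⟨w, hw, he⟩ := convexHull_min (Set.image_mono (subset_conv X))
      (isConvex_conv X).image_klein hz
    rwa [← klein_injective he]

theorem continuous_klein : Continuous klein :=
  (continuous_vu.div continuous_vt fun z => (vt_pos z).ne').prodMk
    (continuous_vs.div continuous_vt fun z => (vt_pos z).ne')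

/-- Closedness is inherited from the Euclidean hull in the Klein chart, boundedness from a ball. -/
theorem isCompact_conv {X : Set ℍ} (hX : X.Finite) : IsCompact (conv X) := by
  refine Metric.isCompact_of_isClosed_isBounded ?_ ?_
  · rw [conv_eq_preimage]
    exact ((hX.image klein).isCompact_convexHull (𝕜 := ℝ)).isClosed.preimage continuous_klein
  · obtain ⟨r, hr⟩ := hX.isBounded.subset_closedBall UpperHalfPlane.I
    exact Metric.isBounded_closedBall.subset (conv_subset_closedBall (le_max_right r 0)
      fun x hx => (Metric.mem_closedBall.1 (hr hx)).trans (le_max_left r 0))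

theorem IsConvex.interior_nonempty {C : Set ℍ} (hC : IsConvex C) {x y z : ℍ} (hx : x ∈ C)
    (hy : y ∈ C) (hz : z ∈ C) (h : 0 < det3 x y z) : (interior C).Nonempty := by
  have hopen : IsOpen {p | 0 < det3 y z p ∧ 0 < det3 z x p ∧ 0 < det3 x y p} :=
    (isOpen_lt continuous_const (continuous_lin _ _ _)).inter
      ((isOpen_lt continuous_const (continuous_lin _ _ _)).inter
        (isOpen_lt continuous_const (continuous_lin _ _ _)))
  obtain ⟨m, q, hq, hm⟩ := exists_comb one_pos one_pos x y
  obtain ⟨o, q', hq', ho⟩ := exists_comb one_pos one_pos m z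
  have h1 : 0 < det3 y z x := by rwa [← det3_cycle]
  have h2 : 0 < det3 z x y := by rwa [det3_cycle]
  refine ⟨o, mem_interior.2 ⟨_, fun p hp => ?_, hopen, ?_, ?_, ?_⟩⟩
  · obtain ⟨a1, a2, a3⟩ := hp
    -- By Cramer's rule the three determinants are barycentric coordinates of `p`; `c` is where the
    -- line from `z` through `p` meets `[x, y]`.
    obtain ⟨c, r, hr, hc⟩ := exists_comb a1 a2 x y
    have hcC : c ∈ C := hC x hx y hy (hc.mem_segment (by positivity) (by positivity))
    refine hC c hcC z hz (Comb.mem_segment (l := 1 / (r * det3 x y z))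
      (m := det3 x y p / det3 x y z) ⟨?_, ?_, ?_⟩ (by positivity) (by positivity))
    · rw [hc.t]
      field_simp
      unfold det3 lin
      ring
    · rw [hc.u]
      field_simp
      unfold det3 lin
      ring
    · rw [hc.s]
      field_simp
      unfold det3 lin
      ring
  · rw [ho.det3, hm.det3, det3_self, det3_self_left]
    simp only [mul_one, mul_zero, add_zero]
    positivity
  · rw [ho.det3, hm.det3, det3_self, det3_self_left]
    simp only [mul_one, mul_zero, add_zero, zero_add]
    positivity
  · rw [ho.det3, hm.det3, det3_self, det3_self_left]
    simp only [mul_one, mul_zero, add_zero, zero_add]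
    positivity

/-! ### Regular polygons -/

theorem exists_polarPoint (R θ : ℝ) : ∃ z : ℍ, vt z = Real.cosh R ∧
    vu z = Real.sinh R * Real.cos θ ∧ vs z = Real.sinh R * Real.sin θ :=
  exists_vec (by
    linear_combination Real.cosh_sq_sub_sinh_sq R -
      Real.sinh R ^ 2 * Real.cos_sq_add_sin_sq θ) (Real.cosh_pos R)

/-- The point with polar coordinates `(R, θ)`. -/
noncomputable def polarPoint (R θ : ℝ) : ℍ := (exists_polarPoint R θ).choose

theorem vt_polarPoint (R θ : ℝ) : vt (polarPoint R θ) = Real.cosh R :=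
  (exists_polarPoint R θ).choose_spec.1

theorem vu_polarPoint (R θ : ℝ) : vu (polarPoint R θ) = Real.sinh R * Real.cos θ :=
  (exists_polarPoint R θ).choose_spec.2.1

theorem vs_polarPoint (R θ : ℝ) : vs (polarPoint R θ) = Real.sinh R * Real.sin θ :=
  (exists_polarPoint R θ).choose_spec.2.2

theorem polarPoint_add_int_mul_two_pi (R θ : ℝ) (m : ℤ) :
    polarPoint R (θ + m * (2 * Real.pi)) = polarPoint R θ := by
  apply ext_vec
  · rw [vt_polarPoint, vt_polarPoint]
  · rw [vu_polarPoint, vu_polarPoint, Real.cos_add_int_mul_two_pi]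
  · rw [vs_polarPoint, vs_polarPoint, Real.sin_add_int_mul_two_pi]

theorem lin_polarPoint (α g ψ R θ : ℝ) :
    lin α (-g * Real.cos ψ) (-g * Real.sin ψ) (polarPoint R θ) =
      α * Real.cosh R - g * Real.sinh R * Real.cos (θ - ψ) := by
  rw [lin, vt_polarPoint, vu_polarPoint, vs_polarPoint, Real.cos_sub]
  ring

theorem cosh_dist_polarPoint (R θ r φ : ℝ) :
    Real.cosh (dist (polarPoint R θ) (polarPoint r φ)) =
      Real.cosh R * Real.cosh r - Real.sinh R * Real.sinh r * Real.cos (θ - φ) := by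
  rw [cosh_dist_eq, vt_polarPoint, vu_polarPoint, vs_polarPoint, vt_polarPoint, vu_polarPoint,
    vs_polarPoint, Real.cos_sub]
  ring

/-- This turns comparisons of angles, all multiples of `π / n`, into integer arithmetic modulo `2 *
n`. -/
theorem cos_int_mul_le {n : ℕ} (hn : 0 < n) {p q r : ℤ} (hq : 0 ≤ q) (hqr : q ≤ r)
    (hr : r ≤ 2 * n - q) (h : p % (2 * n) = r) :
    Real.cos (p * (Real.pi / n)) ≤ Real.cos (q * (Real.pi / n)) := by
  have hn' : (0 : ℝ) < n := by exact_mod_cast hn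
  have hpi := Real.pi_pos
  have e : Real.cos (p * (Real.pi / n)) = Real.cos (r * (Real.pi / n)) := by
    have h1 : (p : ℝ) = r + 2 * n * (p / (2 * n) : ℤ) := by
      rw [← h]
      exact_mod_cast (Int.emod_add_mul_ediv p (2 * n)).symm
    rw [h1, show ((r : ℝ) + 2 * n * (p / (2 * n) : ℤ)) * (Real.pi / n) =
      r * (Real.pi / n) + (p / (2 * n) : ℤ) * (2 * Real.pi) by field_simp]
    exact Real.cos_add_int_mul_two_pi _ _
  rw [e]
  have hq' : (0 : ℝ) ≤ q := by exact_mod_cast hq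
  have hqr' : (q : ℝ) ≤ r := by exact_mod_cast hqr
  have hr' : (r : ℝ) ≤ 2 * n - q := by exact_mod_cast hr
  rcases le_total r n with hrn | hrn
  · have hrn' : (r : ℝ) ≤ n := by exact_mod_cast hrn
    refine Real.cos_le_cos_of_nonneg_of_le_pi (by positivity) ?_ (by gcongr)
    calc (r : ℝ) * (Real.pi / n) ≤ n * (Real.pi / n) := by gcongr
      _ = Real.pi := by field_simp
  · have hrn' : (n : ℝ) ≤ r := by exact_mod_cast hrn
    rw [← Real.cos_two_pi_sub (r * (Real.pi / n)),
      show 2 * Real.pi - r * (Real.pi / n) = (2 * n - r) * (Real.pi / n) by field_simp]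
    refine Real.cos_le_cos_of_nonneg_of_le_pi (by positivity) ?_ (by gcongr; linarith)
    calc (2 * n - r : ℝ) * (Real.pi / n) ≤ n * (Real.pi / n) := by gcongr; linarith
      _ = Real.pi := by field_simp

theorem exists_polar (β γ : ℝ) : ∃ ψ : ℝ, β = -√(β ^ 2 + γ ^ 2) * Real.cos ψ ∧
    γ = -√(β ^ 2 + γ ^ 2) * Real.sin ψ := by
  refine ⟨Complex.arg ⟨-β, -γ⟩, ?_, ?_⟩
  · have := Complex.norm_mul_cos_arg ⟨-β, -γ⟩
    rw [Complex.norm_eq_sqrt_sq_add_sq] at this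
    simp only [neg_sq] at this
    linarith
  · have := Complex.norm_mul_sin_arg ⟨-β, -γ⟩
    rw [Complex.norm_eq_sqrt_sq_add_sq] at this
    simp only [neg_sq] at this
    linarith

/-- Writing the right side as `2 cos (a / 2) cos (x - a / 2)` shows that it is least at the ends of
`[0, a]`. -/
theorem one_add_cos_le {x a : ℝ} (hx : 0 ≤ x) (hxa : x ≤ a) (ha : a ≤ Real.pi) :
    1 + Real.cos a ≤ Real.cos x + Real.cos (a - x) := by
  have h1 : Real.cos x + Real.cos (a - x) = 2 * Real.cos (a / 2) * Real.cos (x - a / 2) := by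
    rw [Real.cos_add_cos]
    ring_nf
  have h2 : 1 + Real.cos a = 2 * Real.cos (a / 2) * Real.cos (a / 2) := by
    have := Real.cos_sq (a / 2)
    rw [show 2 * (a / 2) = a by ring] at this
    linarith
  have h3 : 0 ≤ Real.cos (a / 2) := Real.cos_nonneg_of_mem_Icc ⟨by linarith, by linarith⟩
  have h4 : Real.cos (a / 2) ≤ Real.cos (x - a / 2) := by
    rw [← Real.cos_abs (x - a / 2)]
    refine Real.cos_le_cos_of_nonneg_of_le_pi (abs_nonneg _) (by linarith) ?_
    rw [abs_le]
    constructor <;> linarith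
  rw [h1, h2]
  gcongr

/-- The vertices of the regular `n`-gon with circumradius `R`. -/
noncomputable def regularVertex (n : ℕ) (R : ℝ) (j : ZMod n) : ℍ :=
  polarPoint R (2 * j.val * (Real.pi / n))

theorem regularVertex_intCast {n : ℕ} [NeZero n] (R : ℝ) (m : ℤ) :
    regularVertex n R (m : ZMod n) = polarPoint R (2 * m * (Real.pi / n)) := by
  have hn : (n : ℝ) ≠ 0 := Nat.cast_ne_zero.2 (NeZero.ne n)
  have h1 : (((m : ZMod n).val : ℕ) : ℤ) = m % n := ZMod.val_intCast m
  have h2 : (m : ℝ) = (((m : ZMod n).val : ℕ) : ℝ) + n * (m / n : ℤ) := by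
    have h3 := Int.emod_add_mul_ediv m n
    rw [← h1] at h3
    exact_mod_cast h3.symm
  unfold regularVertex
  rw [h2, show 2 * ((((m : ZMod n).val : ℕ) : ℝ) + n * (m / n : ℤ)) * (Real.pi / n) =
    2 * (((m : ZMod n).val : ℕ) : ℝ) * (Real.pi / n) + (m / n : ℤ) * (2 * Real.pi) by
      field_simp, polarPoint_add_int_mul_two_pi]

theorem forall_regularVertex {n : ℕ} [NeZero n] {R : ℝ} {p : ℍ → Prop} :
    (∀ z ∈ Set.range (regularVertex n R), p z) ↔
      ∀ m : ℤ, p (polarPoint R (2 * m * (Real.pi / n))) := by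
  constructor
  · intro h m
    rw [← regularVertex_intCast]
    exact h _ ⟨_, rfl⟩
  · rintro h _ ⟨j, rfl⟩
    obtain ⟨m, rfl⟩ := ZMod.intCast_surjective j
    rw [regularVertex_intCast]
    exact h m

/-- The regular `n`-gon with circumradius `R`. -/
noncomputable def regularPolygon (n : ℕ) (R : ℝ) : Set ℍ := conv (Set.range (regularVertex n R))

/-- The functional vanishing on a side of the regular `n`-gon with inradius `r`, in terms of the
angle of the midpoint of the side. -/
noncomputable def sideForm (r ψ : ℝ) : ℍ → ℝ :=
  lin (Real.sinh r) (-Real.cosh r * Real.cos ψ) (-Real.cosh r * Real.sin ψ)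

theorem sideForm_polarPoint (r ψ R θ : ℝ) : sideForm r ψ (polarPoint R θ) =
    Real.sinh r * Real.cosh R - Real.cosh r * Real.sinh R * Real.cos (θ - ψ) :=
  lin_polarPoint _ _ _ _ _

theorem sideForm_normalized (r ψ : ℝ) : (-Real.cosh r * Real.cos ψ) ^ 2 +
    (-Real.cosh r * Real.sin ψ) ^ 2 = Real.sinh r ^ 2 + 1 := by
  linear_combination Real.cosh r ^ 2 * Real.cos_sq_add_sin_sq ψ + Real.cosh_sq r

theorem isCompact_regularPolygon {n : ℕ} [NeZero n] {R : ℝ} : IsCompact (regularPolygon n R) :=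
  isCompact_conv (Set.finite_range _)

/-- The separating line is the one through the two neighbours of vertex `i`. -/
theorem regularVertex_separation {n : ℕ} (hn : 3 ≤ n) {R : ℝ} (hR : 0 < R) (i : ZMod n) :
    ∃ α β γ : ℝ, lin α β γ (regularVertex n R i) < 0 ∧
      ∀ j ≠ i, 0 ≤ lin α β γ (regularVertex n R j) := by
  have : NeZero n := ⟨by omega⟩
  have hn' : (3 : ℝ) ≤ n := by exact_mod_cast hn
  have hpi := Real.pi_pos
  obtain ⟨m, rfl⟩ := ZMod.intCast_surjective i
  have hS := Real.sinh_pos_iff.2 hR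
  have hC := Real.cosh_pos R
  refine ⟨Real.sinh R * Real.cos (2 * (Real.pi / n)),
    -Real.cosh R * Real.cos (2 * m * (Real.pi / n)),
    -Real.cosh R * Real.sin (2 * m * (Real.pi / n)), ?_, fun j hj => ?_⟩
  · rw [regularVertex_intCast, lin_polarPoint, sub_self, Real.cos_zero]
    have h1 : Real.cos (2 * (Real.pi / n)) < 1 := by
      rw [← Real.cos_zero]
      refine Real.cos_lt_cos_of_nonneg_of_le_pi le_rfl ?_ (by positivity)
      rw [← mul_div_assoc, div_le_iff₀ (by linarith)]
      nlinarith
    nlinarith [mul_pos hS hC]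
  · obtain ⟨p, rfl⟩ := ZMod.intCast_surjective j
    rw [regularVertex_intCast, lin_polarPoint]
    have hne : ¬ (n : ℤ) ∣ p - m := fun hd =>
      hj ((ZMod.intCast_eq_intCast_iff_dvd_sub m p n).2 hd).symm
    have hmod : ((2 : ℤ) * (p - m)) % (2 * n) = 2 * ((p - m) % n) :=
      Int.mul_emod_mul_of_pos _ _ two_pos
    have h0 := Int.emod_nonneg (p - m) (b := n) (by omega)
    have h1 := Int.emod_lt_of_pos (p - m) (b := n) (by omega)
    have h2 : (p - m) % n ≠ 0 := fun h => hne (Int.dvd_of_emod_eq_zero h)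
    have := cos_int_mul_le (n := n) (q := 2) (by omega) (by norm_num) (by omega) (by omega) hmod
    push_cast at this
    rw [show (2 : ℝ) * p * (Real.pi / n) - 2 * m * (Real.pi / n) = 2 * (p - m) * (Real.pi / n) by
      ring]
    nlinarith [mul_le_mul_of_nonneg_left this (mul_pos hS hC).le]

/-- Here `hr` is `tanh r = cos (π / n) * tanh R` without denominators, the relation in the right
triangle of centre, side midpoint and vertex. Vertices lie at even and side midpoints at odd
multiples of `π / n`, so they differ by at least one step. -/
theorem sideForm_regularPolygon_nonneg {n : ℕ} [NeZero n] {R r : ℝ} (hR : 0 ≤ R)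
    (hr : Real.sinh r * Real.cosh R = Real.cos (Real.pi / n) * Real.sinh R * Real.cosh r) (m : ℤ) :
    ∀ z ∈ regularPolygon n R, 0 ≤ sideForm r ((2 * m + 1) * (Real.pi / n)) z := by
  have hn : 0 < n := Nat.pos_of_ne_zero (NeZero.ne n)
  refine conv_subset (isConvex_lin_nonneg _ _ _) (forall_regularVertex.2 fun p => ?_)
  change 0 ≤ sideForm _ _ _
  rw [sideForm_polarPoint, hr, show (2 : ℝ) * p * (Real.pi / n) - (2 * m + 1) * (Real.pi / n) =
    ((2 * p - (2 * m + 1) : ℤ) : ℝ) * (Real.pi / n) by push_cast; ring]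
  have h0 := Int.emod_nonneg (2 * p - (2 * m + 1)) (b := 2 * n) (by omega)
  have h1 := Int.emod_lt_of_pos (2 * p - (2 * m + 1)) (b := 2 * n) (by omega)
  have h2 := Int.emod_add_mul_ediv (2 * p - (2 * m + 1)) (2 * n)
  rw [mul_assoc] at h2
  have := cos_int_mul_le (n := n) (q := 1) (p := 2 * p - (2 * m + 1)) hn (by norm_num) (by omega)
    (by omega) rfl
  rw [Int.cast_one, one_mul] at this
  nlinarith [mul_le_mul_of_nonneg_left this
    (mul_nonneg (Real.cosh_pos r).le (Real.sinh_nonneg_iff.2 hR))]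

theorem isPolygon_regularPolygon {n : ℕ} (hn : 3 ≤ n) {R r : ℝ} (hR : 0 < R)
    (hr : Real.sinh r * Real.cosh R = Real.cos (Real.pi / n) * Real.sinh R * Real.cosh r) :
    IsPolygon n (regularVertex n R) (regularPolygon n R) := by
  have : NeZero n := ⟨by omega⟩
  have hn' : (3 : ℝ) ≤ n := by exact_mod_cast hn
  have hpi := Real.pi_pos
  have hS := Real.sinh_pos_iff.2 hR
  have hC := Real.cosh_pos R
  have hmem : ∀ j, regularVertex n R j ∈ regularPolygon n R := fun j => subset_conv _ ⟨j, rfl⟩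
  have hinj : Function.Injective (regularVertex n R) := by
    intro i j hij
    by_contra hne
    obtain ⟨α, β, γ, h1, h2⟩ := regularVertex_separation hn hR i
    have h3 := h2 j (Ne.symm hne)
    rw [hij] at h1
    linarith
  refine ⟨rfl, ⟨isConvex_conv _, isCompact_regularPolygon, ?_⟩, hinj, fun i hi => ?_, fun i => ?_⟩
  · refine (isConvex_conv _).interior_nonempty (hmem 0) (hmem 1) (hmem 2) ?_
    have e0 := regularVertex_intCast (n := n) R 0
    have e1 := regularVertex_intCast (n := n) R 1
    have e2 := regularVertex_intCast (n := n) R 2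
    push_cast at e0 e1 e2
    rw [e0, e1, e2]
    simp only [mul_zero, zero_mul, mul_one]
    have ha : 0 < 2 * (Real.pi / n) := by positivity
    have ha' : 2 * (Real.pi / n) < Real.pi := by
      rw [← mul_div_assoc, div_lt_iff₀ (by linarith)]
      nlinarith
    rw [show (2 : ℝ) * 2 * (Real.pi / n) = 2 * (2 * (Real.pi / n)) by ring]
    generalize 2 * (Real.pi / n) = a at ha ha'
    have hsin := Real.sin_pos_of_pos_of_lt_pi ha ha'
    have hcos : Real.cos a < 1 := by
      rw [← Real.cos_zero]
      exact Real.cos_lt_cos_of_nonneg_of_le_pi le_rfl ha'.le ha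
    have e : det3 (polarPoint R 0) (polarPoint R a) (polarPoint R (2 * a)) =
        2 * Real.cosh R * Real.sinh R ^ 2 * Real.sin a * (1 - Real.cos a) := by
      unfold det3 lin
      simp only [vt_polarPoint, vu_polarPoint, vs_polarPoint, Real.cos_zero, Real.sin_zero,
        Real.cos_two_mul, Real.sin_two_mul]
      ring
    rw [e]
    have : 0 < 1 - Real.cos a := by linarith
    positivity
  · obtain ⟨α, β, γ, h1, h2⟩ := regularVertex_separation hn hR i
    have h3 : regularVertex n R i ∈ {z | 0 ≤ lin α β γ z} := by
      refine conv_subset (isConvex_lin_nonneg α β γ) ?_ hi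
      rintro _ ⟨⟨j, rfl⟩, hj⟩
      exact h2 j fun h => hj (by rw [h]; rfl)
    exact absurd h3 (not_le.2 h1)
  · obtain ⟨m, rfl⟩ := ZMod.intCast_surjective i
    have hv : ∀ p : ℤ, p = m ∨ p = m + 1 → sideForm r ((2 * m + 1) * (Real.pi / n))
        (regularVertex n R (p : ZMod n)) = 0 := by
      intro p hp
      rw [regularVertex_intCast, sideForm_polarPoint, hr]
      rcases hp with rfl | rfl
      · rw [show (2 : ℝ) * p * (Real.pi / n) - (2 * p + 1) * (Real.pi / n) = -(Real.pi / n) by ring,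
          Real.cos_neg]
        ring
      · push_cast
        rw [show (2 : ℝ) * (m + 1) * (Real.pi / n) - (2 * m + 1) * (Real.pi / n) =
          Real.pi / n by ring]
        ring
    refine ⟨_, isSupportingLine_iff_normalized.2 ⟨_, _, _, sideForm_normalized r _, rfl,
      sideForm_regularPolygon_nonneg hR.le hr m, _, hmem m, hv m (Or.inl rfl)⟩,
      hv m (Or.inl rfl), ?_⟩
    have := hv (m + 1) (Or.inr rfl)
    push_cast at this
    exact this

/-- A side line attains `R + r`. For any other nonnegative functional, the constraint at the vertex
nearest its direction bounds it below at one of the two vertices nearly opposite. -/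
theorem minimalWidth_regularPolygon {k : ℕ} (hk : 1 ≤ k) {R r : ℝ} (hR : 0 < R)
    (hr : Real.sinh r * Real.cosh R =
      Real.cos (Real.pi / (2 * k + 1 : ℕ)) * Real.sinh R * Real.cosh r) :
    minimalWidth (regularPolygon (2 * k + 1) R) = R + r := by
  have hn' : (3 : ℝ) ≤ (2 * k + 1 : ℕ) := by exact_mod_cast (by omega : 3 ≤ 2 * k + 1)
  have hpi := Real.pi_pos
  have hS := Real.sinh_pos_iff.2 hR
  have hC := Real.cosh_pos R
  have hc := Real.cosh_pos r
  have hmem : ∀ j, regularVertex (2 * k + 1) R j ∈ regularPolygon (2 * k + 1) R :=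
    fun j => subset_conv _ ⟨j, rfl⟩
  have hna : ((2 * k + 1 : ℕ) : ℝ) * (Real.pi / (2 * k + 1 : ℕ)) = Real.pi := by field_simp
  have ha : 0 < Real.pi / (2 * k + 1 : ℕ) := by positivity
  have ha' : Real.pi / (2 * k + 1 : ℕ) < Real.pi / 2 := by
    gcongr
    linarith
  have hadd : Real.sinh (R + r) =
      Real.sinh R * Real.cosh r * (1 + Real.cos (Real.pi / (2 * k + 1 : ℕ))) := by
    rw [Real.sinh_add]
    linear_combination hr
  have hs0 : 0 ≤ Real.sinh r := by
    have := Real.cos_nonneg_of_mem_Icc ⟨by linarith, ha'.le⟩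
    refine nonneg_of_mul_nonneg_left (b := Real.cosh R) ?_ hC
    rw [hr]
    positivity
  have hsw : 0 ≤ Real.sinh (R + r) := by
    rw [Real.sinh_add]
    positivity
  refine minimalWidth_eq isCompact_regularPolygon ?_ ?_
  · have h0 := sideForm_regularPolygon_nonneg hR.le hr 0
    refine ⟨_, _, _, sideForm_normalized r _, h0, ⟨_, hmem (0 : ℤ), ?_⟩, ?_⟩
    · rw [regularVertex_intCast]
      change sideForm _ _ _ = 0
      rw [sideForm_polarPoint, hr]
      simp only [Int.cast_zero, mul_zero, zero_mul, zero_add, one_mul, zero_sub, Real.cos_neg]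
      ring
    · refine conv_subset (isConvex_lin_le _ _ _ hsw) (forall_regularVertex.2 fun p => ?_)
      change sideForm _ _ _ ≤ _
      rw [sideForm_polarPoint, Real.sinh_add]
      nlinarith [mul_le_mul_of_nonneg_left (Real.neg_one_le_cos (2 * p * (Real.pi /
        (2 * k + 1 : ℕ)) - (2 * (0 : ℤ) + 1) * (Real.pi / (2 * k + 1 : ℕ)))) (mul_pos hc hS).le]
  · intro α β γ hnorm hpos
    obtain ⟨ψ, hβ, hγ⟩ := exists_polar β γ
    have hg2 : √(β ^ 2 + γ ^ 2) ^ 2 = α ^ 2 + 1 := by rw [Real.sq_sqrt (by positivity), hnorm]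
    have hg0 : 0 ≤ √(β ^ 2 + γ ^ 2) := Real.sqrt_nonneg _
    generalize √(β ^ 2 + γ ^ 2) = g at *
    subst hβ hγ
    clear hnorm
    have hL : ∀ p : ℤ, lin α (-g * Real.cos ψ) (-g * Real.sin ψ)
        (regularVertex (2 * k + 1) R p) = α * Real.cosh R - g * Real.sinh R *
          Real.cos (2 * p * (Real.pi / (2 * k + 1 : ℕ)) - ψ) := fun p => by
      rw [regularVertex_intCast, lin_polarPoint]
    set a := Real.pi / (2 * k + 1 : ℕ) with hadef
    -- Vertex `m` is the one nearest the direction `ψ`, with angular offset `δ` of at most half a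
    -- step.
    set m := round (ψ / (2 * a)) with hm
    obtain ⟨δ, hδ⟩ : ∃ δ, δ = 2 * m * a - ψ := ⟨_, rfl⟩
    have hδa : |δ| ≤ a := by
      have h1 := abs_sub_round (ψ / (2 * a))
      rw [← hm, abs_sub_comm] at h1
      rw [hδ, show 2 * m * a - ψ = 2 * a * (m - ψ / (2 * a)) by field_simp, abs_mul,
        abs_of_pos (by positivity : 0 < 2 * a)]
      nlinarith
    have h1 := hpos _ (hmem m)
    rw [hL, ← hδ, ← Real.cos_abs] at h1
    have h2 : Real.cos a ≤ Real.cos |δ| :=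
      Real.cos_le_cos_of_nonneg_of_le_pi (abs_nonneg _) (by linarith) hδa
    have h3 := one_add_cos_le (abs_nonneg δ) hδa (by linarith)
    have hgS : 0 ≤ g * Real.sinh R := by positivity
    -- A line missing the interior of the polygon is at least `r` away from the centre; here `g` and
    -- `α` are `cosh` and `sinh` of that signed distance.
    have h4 : Real.cosh r ≤ g := by
      have h5 : g * Real.sinh r ≤ α * Real.cosh r := by
        have h6 : g * Real.sinh r * Real.cosh R ≤ α * Real.cosh r * Real.cosh R := by
          have h7 : g * Real.sinh r * Real.cosh R = g * Real.sinh R * Real.cos a * Real.cosh r := by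
            linear_combination g * hr
          rw [h7]
          nlinarith [mul_le_mul_of_nonneg_left h2 hgS]
        exact le_of_mul_le_mul_right h6 hC
      have h6 := mul_self_le_mul_self (mul_nonneg hg0 hs0) h5
      have h7 := Real.cosh_sq r
      have h8 : Real.cosh r ^ 2 ≤ g ^ 2 := by
        have e1 : g ^ 2 * Real.cosh r ^ 2 = g ^ 2 * (Real.sinh r ^ 2 + 1) := by rw [h7]
        have e2 : g ^ 2 * Real.cosh r ^ 2 = (α ^ 2 + 1) * Real.cosh r ^ 2 := by rw [hg2]
        linarith
      exact le_of_sq_le_sq h8 hg0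
    have h5 : Real.sinh (R + r) ≤ α * Real.cosh R + g * Real.sinh R * Real.cos (a - |δ|) := by
      rw [hadd]
      have e1 := mul_le_mul_of_nonneg_left h3 hgS
      have e2 : 0 ≤ Real.sinh R * (1 + Real.cos a) := by
        have := Real.neg_one_le_cos a
        exact mul_nonneg hS.le (by linarith)
      have e3 := mul_le_mul_of_nonneg_right h4 e2
      linarith
    -- As `n` is odd, `-ψ` falls between vertices `m + k` and `m + k + 1` seen from the centre; the
    -- sign of `δ` selects the nearer one.
    rcases le_total 0 δ with h0 | h0
    · refine ⟨_, hmem ((m + k : ℤ) : ZMod _), ?_⟩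
      rw [hL]
      push_cast at hna ⊢
      rw [show 2 * ((m : ℝ) + k) * a - ψ = Real.pi - (a - δ) by rw [hδ, ← hna]; ring,
        Real.cos_pi_sub]
      rw [abs_of_nonneg h0] at h5
      linarith
    · refine ⟨_, hmem ((m + k + 1 : ℤ) : ZMod _), ?_⟩
      rw [hL]
      push_cast at hna ⊢
      rw [show 2 * ((m : ℝ) + k + 1) * a - ψ = (a + δ) + Real.pi by rw [hδ, ← hna]; ring,
        Real.cos_add_pi]
      rw [abs_of_nonpos h0, sub_neg_eq_add] at h5
      linarith

theorem isOrdinaryReducedPolygon_regularPolygon {k : ℕ} (hk : 1 ≤ k) {R r : ℝ} (hR : 0 < R)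
    (hr : Real.sinh r * Real.cosh R =
      Real.cos (Real.pi / (2 * k + 1 : ℕ)) * Real.sinh R * Real.cosh r) :
    IsOrdinaryReducedPolygon (regularPolygon (2 * k + 1) R) := by
  refine ⟨k, regularVertex (2 * k + 1) R, isPolygon_regularPolygon (by omega) hR hr, fun i => ?_⟩
  rw [minimalWidth_regularPolygon hk hR hr]
  obtain ⟨m, rfl⟩ := ZMod.intCast_surjective i
  have hn' : (3 : ℝ) ≤ (2 * k + 1 : ℕ) := by exact_mod_cast (by omega : 3 ≤ 2 * k + 1)
  have hpi := Real.pi_pos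
  have hS := Real.sinh_pos_iff.2 hR
  have hC := Real.cosh_pos R
  have hc := Real.cosh_pos r
  have hna : ((2 * k + 1 : ℕ) : ℝ) * (Real.pi / (2 * k + 1 : ℕ)) = Real.pi := by field_simp
  have ha : 0 < Real.pi / (2 * k + 1 : ℕ) := by positivity
  have ha' : Real.pi / (2 * k + 1 : ℕ) < Real.pi / 2 := by
    gcongr
    linarith
  have e0 := regularVertex_intCast (n := 2 * k + 1) R m
  have e1 := regularVertex_intCast (n := 2 * k + 1) R (m + k)
  have e2 := regularVertex_intCast (n := 2 * k + 1) R (m + k + 1)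
  set a := Real.pi / (2 * k + 1 : ℕ) with hadef
  push_cast at e1 e2 hna
  obtain ⟨θ, hθ⟩ : ∃ θ, θ = 2 * m * a := ⟨_, rfl⟩
  rw [show 2 * ((m : ℝ) + k) * a = θ + Real.pi - a by rw [hθ, ← hna]; ring] at e1
  rw [show 2 * ((m : ℝ) + k + 1) * a = θ + Real.pi + a by rw [hθ, ← hna]; ring] at e2
  rw [← hθ] at e0
  rw [e0, e1, e2]
  have hκ := Real.cos_pos_of_mem_Ioo ⟨by linarith, ha'⟩
  have hκ1 : Real.cos a < 1 := by
    rw [← Real.cos_zero]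
    exact Real.cos_lt_cos_of_nonneg_of_le_pi le_rfl (by linarith) ha
  have hr0 : 0 < r := by
    rw [← Real.sinh_pos_iff]
    refine pos_of_mul_pos_left ?_ hC.le
    rw [hr]
    positivity
  have hrR : r < R := by
    have h1 : 0 < Real.sinh (R - r) := by
      rw [Real.sinh_sub]
      nlinarith [mul_pos (mul_pos hS hc) (sub_pos.2 hκ1)]
    linarith [Real.sinh_pos_iff.1 h1]
  -- The foot of the altitude is the midpoint of the opposite side, so the altitude runs through the
  -- centre and has length `R + r`.
  have hcomb : Comb (Real.cosh r / (2 * Real.cosh R)) (Real.cosh r / (2 * Real.cosh R))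
      (polarPoint r (θ + Real.pi)) (polarPoint R (θ + Real.pi - a))
      (polarPoint R (θ + Real.pi + a)) := by
    refine ⟨?_, ?_, ?_⟩
    · simp only [vt_polarPoint]
      field_simp
      ring
    · simp only [vu_polarPoint]
      rw [Real.cos_sub, Real.cos_add (θ + Real.pi) a]
      field_simp
      linear_combination 2 * Real.cos (θ + Real.pi) * hr
    · simp only [vs_polarPoint]
      rw [Real.sin_sub, Real.sin_add (θ + Real.pi) a]
      field_simp
      linear_combination 2 * Real.sin (θ + Real.pi) * hr
  have hseg := hcomb.mem_segment (by positivity) (by positivity)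
  have hF1 : sideForm r (θ + Real.pi) (polarPoint R (θ + Real.pi - a)) = 0 := by
    rw [sideForm_polarPoint, show θ + Real.pi - a - (θ + Real.pi) = -a by ring, Real.cos_neg]
    linarith
  have hF2 : sideForm r (θ + Real.pi) (polarPoint R (θ + Real.pi + a)) = 0 := by
    rw [sideForm_polarPoint, show θ + Real.pi + a - (θ + Real.pi) = a by ring]
    linarith
  have hF : ∀ z ∈ segment (polarPoint R (θ + Real.pi - a)) (polarPoint R (θ + Real.pi + a)),
      sideForm r (θ + Real.pi) z = 0 := by
    intro z hz
    obtain ⟨p, q, -, -, h⟩ := mem_segment_iff.1 hz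
    change lin _ _ _ z = 0
    rw [h.lin]
    change p * sideForm _ _ _ + q * sideForm _ _ _ = 0
    rw [hF1, hF2]
    ring
  have hdist : dist (polarPoint R θ) (polarPoint r (θ + Real.pi)) = R + r := by
    have h1 : Real.cosh (dist (polarPoint R θ) (polarPoint r (θ + Real.pi))) =
        Real.cosh (R + r) := by
      rw [cosh_dist_polarPoint, Real.cosh_add, show θ - (θ + Real.pi) = -Real.pi by ring,
        Real.cos_neg, Real.cos_pi]
      ring
    have h2 := Real.cosh_le_cosh.1 h1.le
    have h3 := Real.cosh_le_cosh.1 h1.ge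
    rw [abs_of_nonneg dist_nonneg, abs_of_pos (by linarith)] at *
    linarith
  have hnear : ∀ z, sideForm r (θ + Real.pi) z = 0 → R + r ≤ dist (polarPoint R θ) z := by
    intro z hz
    have h1 := abs_lin_le_sinh_dist (sideForm_normalized r (θ + Real.pi)) hz (polarPoint R θ)
    have h2 : sideForm r (θ + Real.pi) (polarPoint R θ) = Real.sinh (R + r) := by
      rw [sideForm_polarPoint, Real.sinh_add, show θ - (θ + Real.pi) = -Real.pi by ring,
        Real.cos_neg, Real.cos_pi]
      ring
    rw [← Real.sinh_le_sinh, ← h2]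
    exact (le_abs_self _).trans h1
  refine ⟨le_antisymm ?_ ?_, {z | sideForm r (θ + Real.pi) z = 0}, polarPoint r (θ + Real.pi),
    isLine_iff.2 ⟨_, _, _, ?_, rfl⟩, hF1, hF2, ⟨hF _ hseg, fun z hz => ?_⟩, hseg, ?_⟩
  · rw [← hdist]
    exact Metric.infDist_le_dist_of_mem hseg
  · rw [Metric.le_infDist ⟨_, hseg⟩]
    exact fun {z} hz => hnear z (hF z hz)
  · rw [sideForm_normalized]
    linarith
  · rw [hdist]
    exact hnear z hz
  · have hlt : Real.cosh r < Real.cosh R := by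
      rw [Real.cosh_lt_cosh, abs_of_pos hr0, abs_of_pos hR]
      exact hrR
    rintro (h | h)
    · have := congrArg vt h
      rw [vt_polarPoint, vt_polarPoint] at this
      exact hlt.ne this
    · have := congrArg vt h
      rw [vt_polarPoint, vt_polarPoint] at this
      exact hlt.ne this

theorem diam_regularPolygon_le {n : ℕ} [NeZero n] {R : ℝ} (hR : 0 ≤ R) :
    Metric.diam (regularPolygon n R) ≤ 2 * R := by
  refine (Metric.diam_mono (conv_subset_closedBall (p := polarPoint 0 0) hR
    (forall_regularVertex.2 fun m => ?_)) Metric.isBounded_closedBall).trans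
    (Metric.diam_closedBall hR)
  rw [← abs_of_nonneg (dist_nonneg (x := polarPoint R _)), ← abs_of_nonneg hR,
    ← Real.cosh_le_cosh, abs_of_nonneg hR, cosh_dist_polarPoint]
  simp

/-- Two adjacent vertices suffice, since the bound is needed for triangles. -/
theorem le_cosh_diam_regularPolygon (n : ℕ) [NeZero n] (R : ℝ) :
    Real.cosh R ^ 2 - Real.sinh R ^ 2 * Real.cos (2 * (Real.pi / n)) ≤
      Real.cosh (Metric.diam (regularPolygon n R)) := by
  have h := Metric.dist_le_diam_of_mem (isCompact_regularPolygon (n := n) (R := R)).isBounded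
    (subset_conv _ ⟨((1 : ℤ) : ZMod n), rfl⟩) (subset_conv _ ⟨((0 : ℤ) : ZMod n), rfl⟩)
  refine le_trans (le_of_eq ?_) (cosh_le_cosh_of_le dist_nonneg h)
  rw [regularVertex_intCast, regularVertex_intCast, cosh_dist_polarPoint]
  simp only [Int.cast_zero, Int.cast_one, mul_zero, zero_mul, mul_one, sub_zero]
  ring

/-! ### Optimality of the bounds -/

theorem IsOrdinaryReducedPolygon.bounds {P : Set ℍ} (h : IsOrdinaryReducedPolygon P) :
    1 < Metric.diam P / minimalWidth P ∧ Metric.diam P / minimalWidth P < 2 := by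
  obtain ⟨k, v, hv, h⟩ := h
  obtain ⟨h0, h1, h2⟩ := hv.diam_bounds h
  exact ⟨(one_lt_div h0).2 h1, (div_lt_iff₀ h0).2 h2⟩

theorem exists_inradius (R : ℝ) {κ : ℝ} (h0 : 0 ≤ κ) (h1 : κ ≤ 1) :
    ∃ r, Real.sinh r * Real.cosh R = κ * Real.sinh R * Real.cosh r := by
  have hC := Real.cosh_pos R
  have hlt := Real.abs_tanh_lt_one R
  have habs : |κ * Real.tanh R| < 1 := by
    rw [abs_mul, abs_of_nonneg h0]
    nlinarith [abs_nonneg (Real.tanh R)]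
  have ht := Real.tanh_artanh (abs_lt.1 habs)
  refine ⟨Real.artanh (κ * Real.tanh R), ?_⟩
  have hc := Real.cosh_pos (Real.artanh (κ * Real.tanh R))
  generalize Real.artanh (κ * Real.tanh R) = r at *
  rw [Real.tanh_eq_sinh_div_cosh, Real.tanh_eq_sinh_div_cosh] at ht
  field_simp at ht
  linarith

theorem tendsto_cos_pi_div_odd :
    Filter.Tendsto (fun k : ℕ => Real.cos (Real.pi / (2 * k + 1 : ℕ))) Filter.atTop (nhds 1) := by
  have h1 : Filter.Tendsto (fun k : ℕ => 2 * k + 1) Filter.atTop Filter.atTop :=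
    Filter.tendsto_atTop_mono (fun k => by simp only [id]; omega) Filter.tendsto_id
  have h2 := (tendsto_const_div_atTop_nhds_zero_nat Real.pi).comp h1
  have h3 := (Real.continuous_cos.tendsto 0).comp h2
  rwa [Real.cos_zero] at h3

theorem exists_ratio_lt {b : ℝ} (hb : 1 < b) : ∃ x ∈ diamWidthRatios, x < b := by
  have hS : 0 < Real.sinh 1 := Real.sinh_pos_iff.2 one_pos
  have hC := Real.cosh_pos 1
  have hr0 : 2 / b - 1 < 1 := by
    rw [sub_lt_iff_lt_add, div_lt_iff₀ (by linarith)]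
    linarith
  have hb0 : 0 < 2 / b := by positivity
  have hb2 : b * (2 / b) = 2 := by field_simp
  -- The inradius for which `2 / (1 + r₀) = b`; any larger `r` brings the ratio below `b`.
  obtain ⟨r₀, hr₀⟩ : ∃ x, x = 2 / b - 1 := ⟨_, rfl⟩
  have hc0 := Real.cosh_pos r₀
  have hlim : Real.sinh r₀ * Real.cosh 1 / (Real.sinh 1 * Real.cosh r₀) < 1 := by
    rw [div_lt_one (by positivity)]
    have h1 : 0 < Real.sinh (1 - r₀) := Real.sinh_pos_iff.2 (by
      rw [hr₀]
      nlinarith)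
    rw [Real.sinh_sub] at h1
    linarith
  obtain ⟨k, hk, hk1⟩ := ((tendsto_cos_pi_div_odd.eventually (lt_mem_nhds hlim)).and
    (Filter.eventually_ge_atTop 1)).exists
  have hn' : (3 : ℝ) ≤ (2 * k + 1 : ℕ) := by exact_mod_cast (by omega : 3 ≤ 2 * k + 1)
  have hpi := Real.pi_pos
  have hκ : 0 ≤ Real.cos (Real.pi / (2 * k + 1 : ℕ)) := by
    refine Real.cos_nonneg_of_mem_Icc
      ⟨by linarith [show 0 ≤ Real.pi / (2 * k + 1 : ℕ) by positivity], ?_⟩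
    gcongr
    linarith
  obtain ⟨r, hr⟩ := exists_inradius 1 hκ (Real.cos_le_one _)
  have hc := Real.cosh_pos r
  refine ⟨_, ⟨_, isOrdinaryReducedPolygon_regularPolygon hk1 one_pos hr, rfl⟩, ?_⟩
  rw [minimalWidth_regularPolygon hk1 one_pos hr]
  have hlt : r₀ < r := by
    rw [div_lt_iff₀ (by positivity)] at hk
    have h1 : 0 < Real.sinh (r - r₀) * Real.cosh 1 := by
      rw [Real.sinh_sub, sub_mul, mul_right_comm, hr]
      nlinarith [mul_lt_mul_of_pos_right hk hc]
    linarith [Real.sinh_pos_iff.1 (pos_of_mul_pos_left h1 hC.le)]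
  have hd := diam_regularPolygon_le (n := 2 * k + 1) zero_le_one
  rw [div_lt_iff₀ (by linarith)]
  nlinarith

theorem exists_lt_ratio {b : ℝ} (hb : b < 2) : ∃ x ∈ diamWidthRatios, b < x := by
  -- For the triangle, `r ≤ 1` and the diameter is at least `2 * R - 2`. When `b ≥ 0`, `2 * R - 2 >
  -- b * (R + 1)` suffices, that is `(2 - b) * R > b + 2`; this `R` also serves negative `b`.
  obtain ⟨R, hRdef⟩ : ∃ R, R = (|b| + 3) / (2 - b) := ⟨_, rfl⟩
  have hb' : 0 < 2 - b := by linarith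
  have hbR : (2 - b) * R = |b| + 3 := by
    rw [hRdef]
    field_simp
  have hR : 0 < R := by
    rw [hRdef]
    positivity
  have hcos : Real.cos (Real.pi / (2 * 1 + 1 : ℕ)) = 1 / 2 := by
    norm_num
  obtain ⟨r, hr⟩ := exists_inradius R (κ := Real.cos (Real.pi / (2 * 1 + 1 : ℕ)))
    (by rw [hcos]; norm_num) (Real.cos_le_one _)
  refine ⟨_, ⟨_, isOrdinaryReducedPolygon_regularPolygon le_rfl hR hr, rfl⟩, ?_⟩
  rw [minimalWidth_regularPolygon le_rfl hR hr]
  have hd := le_cosh_diam_regularPolygon (2 * 1 + 1) R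
  have hS := Real.sinh_pos_iff.2 hR
  have hC := Real.cosh_pos R
  have hc := Real.cosh_pos r
  have hr0 : 0 < r := by
    rw [← Real.sinh_pos_iff]
    refine pos_of_mul_pos_left ?_ hC.le
    rw [hr, hcos]
    positivity
  have hr1 : r ≤ 1 := by
    have h1 : Real.sinh r * Real.cosh R ≤ (Real.cosh r / 2) * Real.cosh R := by
      rw [hr, hcos]
      nlinarith [mul_lt_mul_of_pos_right (Real.sinh_lt_cosh R) hc]
    have h2 := le_of_mul_le_mul_right h1 hC
    rw [Real.sinh_eq, Real.cosh_eq] at h2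
    have h3 : Real.exp r * Real.exp r ≤ 3 := by
      have h4 : Real.exp (-r) * Real.exp r = 1 := by rw [← Real.exp_add]; simp
      nlinarith [Real.exp_pos r]
    rw [← Real.exp_add] at h3
    linarith [Real.add_one_le_exp (r + r)]
  have hd0 : 0 ≤ Metric.diam (regularPolygon (2 * 1 + 1) R) := Metric.diam_nonneg
  generalize Metric.diam (regularPolygon (2 * 1 + 1) R) = d at *
  have hcos2 : Real.cos (2 * (Real.pi / (2 * 1 + 1 : ℕ))) ≤ 0 := by
    rw [Real.cos_two_mul, hcos]
    norm_num
  -- Chain: `exp (2 * R) ≤ 4 * cosh R ^ 2 ≤ 4 * cosh d ≤ 4 * exp |d|`, and `4 ≤ exp 2`.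
  have h1 : Real.exp (2 * R - 2) ≤ Real.exp |d| := by
    have e1 : Real.cosh d ≤ Real.exp |d| := by
      rw [← Real.cosh_abs]
      linarith [Real.cosh_add_sinh |d|, Real.sinh_nonneg_iff.2 (abs_nonneg d)]
    have e2 : Real.exp R ≤ 2 * Real.cosh R := by
      rw [Real.cosh_eq]
      linarith [Real.exp_pos (-R)]
    have e3 : Real.exp (2 * R - 2) * (Real.exp 1 * Real.exp 1) = Real.exp R * Real.exp R := by
      rw [← Real.exp_add, ← Real.exp_add, ← Real.exp_add]
      ring_nf
    have e4 : 4 ≤ Real.exp 1 * Real.exp 1 := by nlinarith [Real.add_one_le_exp 1]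
    have e5 : Real.exp R * Real.exp R ≤ 4 * Real.cosh R ^ 2 := by nlinarith [Real.exp_pos R]
    have e6 : Real.cosh R ^ 2 ≤ Real.cosh d := by nlinarith [sq_nonneg (Real.sinh R)]
    nlinarith [Real.exp_pos (2 * R - 2)]
  rw [abs_of_nonneg hd0, Real.exp_le_exp] at h1
  rw [lt_div_iff₀ (by linarith)]
  rcases le_total b 0 with h2 | h2
  · rw [abs_of_nonpos h2] at hbR
    nlinarith
  · rw [abs_of_nonneg h2] at hbR
    nlinarith

end HypPlane

theorem mainTheorem6 :
    (∀ P : Set UpperHalfPlane, HypPlane.IsOrdinaryReducedPolygon P →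
      1 < Metric.diam P / HypPlane.minimalWidth P ∧
        Metric.diam P / HypPlane.minimalWidth P < 2) ∧
    IsGLB HypPlane.diamWidthRatios 1 ∧ IsLUB HypPlane.diamWidthRatios 2 := by
  refine ⟨fun P hP => hP.bounds, ⟨?_, fun b hb => ?_⟩, ?_, fun b hb => ?_⟩
  · rintro _ ⟨P, hP, rfl⟩
    exact hP.bounds.1.le
  · by_contra! hlt
    obtain ⟨x, hx, hxb⟩ := HypPlane.exists_ratio_lt hlt
    exact absurd (hb hx) (not_le.2 hxb)
  · rintro _ ⟨P, hP, rfl⟩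
    exact hP.bounds.2.le
  · by_contra! hlt
    obtain ⟨x, hx, hxb⟩ := HypPlane.exists_lt_ratio hlt
    exact absurd (hb hx) (not_le.2 hxb)
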